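/- Let $q$ be a power of a prime (any prime, including $2$ and $3$) and let $\mathbb{F}_q$ be the finite field with $q$ elements. A generalized Hessian curve over $\mathbb{F}_q$ is a curve $$E_{u,v}:\quad X^3+Y^3+v=uXY,\qquad u,v\in\mathbb{F}_q,\ v\neq 0,\ u^3\neq 27v,$$ regarded as an elliptic curve with neutral element the point $(1:-1:0)$ at infinity of its projective closure. Two such curves are isomorphic over $\mathbb{F}_q$ if Weierstrass equations over $\mathbb{F}_q$ of the two elliptic curves are related by an admissible change of variables $X\mapsto \alpha^2X+\beta$, $Y\mapsto \alpha^3Y+\alpha^2\gamma X+\delta$ with $\alpha,\beta,\gamma,\delta\in\mathbb{F}_q$, $\alpha\neq 0$. Let $I_{\mathrm{GH}}(q)$ be the number of $\mathbb{F}_q$-isomorphism classes of generalized Hessian curves over $\mathbb{F}_q$, and let $J_{\mathrm{GH}}(q)$ be the number of distinct $j$-invariants of these curves. Then $$I_{\mathrm{GH}}(q)=\begin{cases}\left\lfloor \dfrac{3(q+3)}{4}\right\rfloor, & q\equiv 1 \pmod 3,\\[2mm] q-1, & q\equiv 0,2\pmod 3,\end{cases}$$ and moreover $I_{\mathrm{GH}}(q)=J_{\mathrm{GH}}(q)+2$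 if $q\equiv 1\pmod 3$. -/

import Mathlib

/-- A triple of linear forms, given by the rows of `M`, substituted into a ternary form `G`:
the pull-back of `G` under the linear map `P ↦ M *ᵥ P`. -/
noncomputable def linSubst {F : Type*} [Field F] (M : Matrix (Fin 3) (Fin 3) F)
    (G : MvPolynomial (Fin 3) F) : MvPolynomial (Fin 3) F :=
  MvPolynomial.bind₁
    (fun i => ∑ j, MvPolynomial.C (M i j) * (MvPolynomial.X j : MvPolynomial (Fin 3) F)) G

/-- The homogeneous equation `X³ + Y³ + v Z³ - u X Y Z` of the projective closure of the
generalized Hessian curve `X³ + Y³ + v = u X Y`. -/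
noncomputable def ghPolynomial {F : Type*} [Field F] (u v : F) : MvPolynomial (Fin 3) F :=
  MvPolynomial.X 0 ^ 3 + MvPolynomial.X 1 ^ 3 + MvPolynomial.C v * MvPolynomial.X 2 ^ 3
    - MvPolynomial.C u * MvPolynomial.X 0 * MvPolynomial.X 1 * MvPolynomial.X 2

/-- The family of generalized Hessian curves over `F`: the pairs `(u, v)` with `v ≠ 0` and
`u³ ≠ 27 v`. -/
structure GHCurve (F : Type*) [Field F] where
  u : F
  v : F
  v_ne_zero : v ≠ 0
  nonsingular : u ^ 3 ≠ 27 * v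

/-- `W` is a Weierstrass equation over `F` of the generalized Hessian curve `E`: an invertible
linear change of the projective coordinates over `F` turns the equation of `E` into that of `W`
(up to a non-zero factor) and the point at infinity `(0 : 1 : 0)` of `W` corresponds to the rational
flex `(1 : -1 : 0)`, the point at infinity of `E` that serves as the neutral element. -/
def IsWeierstrassModel {F : Type*} [Field F] (E : GHCurve F) (W : WeierstrassCurve F) : Prop :=
  ∃ (M : Matrix.GeneralLinearGroup (Fin 3) F) (c d : Fˣ),
    linSubst M.val (ghPolynomial E.u E.v)
        = MvPolynomial.C (c : F) * WeierstrassCurve.Projective.polynomial W.toProjective ∧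
      M.val.mulVec ![0, 1, 0] = (d : F) • ![1, -1, 0]

/-- Two generalized Hessian curves are isomorphic over `F` if Weierstrass equations of them are
related by an admissible change of variables with coefficients in `F`. -/
def GHIso {F : Type*} [Field F] (E E' : GHCurve F) : Prop :=
  ∃ W W' : WeierstrassCurve F, IsWeierstrassModel E W ∧ IsWeierstrassModel E' W' ∧
    ∃ C : WeierstrassCurve.VariableChange F, C • W = W'

/-- A Weierstrass equation, valid in every characteristic, of the generalized Hessian curve. -/
def ghWeierstrass {F : Type*} [Field F] (E : GHCurve F) : WeierstrassCurve F :=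
  ⟨E.u, 0, 9 * E.v, -9 * E.u * E.v, -E.v * (E.u ^ 3 + 27 * E.v)⟩

theorem linSubst_mul {F : Type*} [Field F] (M N : Matrix (Fin 3) (Fin 3) F)
    (G : MvPolynomial (Fin 3) F) : linSubst N (linSubst M G) = linSubst (M * N) G := by
  simp only [linSubst, MvPolynomial.bind₁_bind₁]
  congr 2
  funext i
  simp only [Fin.sum_univ_three, Matrix.mul_apply, map_add, map_mul, MvPolynomial.bind₁_X_right,
    MvPolynomial.algHom_C, MvPolynomial.algebraMap_eq]
  ring

theorem ghWeierstrass_isWeierstrassModel {F : Type*} [Field F] (E : GHCurve F) :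
    IsWeierstrassModel E (ghWeierstrass E) := by
  obtain ⟨u, v, hv, h⟩ := E
  obtain ⟨D, hD⟩ : ∃ D : F, D = 27 * v - u ^ 3 := ⟨_, rfl⟩
  have hD0 : D ≠ 0 := by rw [hD]; exact fun h0 => h (by linear_combination -h0)
  have hdet : (!![0, -1, 0; u, 1, 9 * v; -3, 0, -u ^ 2] : Matrix (Fin 3) (Fin 3) F).det ≠ 0 := by
    have : (!![0, -1, 0; u, 1, 9 * v; -3, 0, -u ^ 2] : Matrix (Fin 3) (Fin 3) F).det = D := by
      rw [Matrix.det_fin_three, hD]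
      simp
      ring
    rwa [this]
  refine ⟨Matrix.GeneralLinearGroup.mkOfDetNeZero _ hdet, Units.mk0 D hD0, -1,
    ?_, ?_⟩
  · change linSubst (!![0, -1, 0; u, 1, 9 * v; -3, 0, -u ^ 2]) _ = _
    simp only [linSubst, ghPolynomial, ghWeierstrass, WeierstrassCurve.Projective.polynomial,
      Fin.sum_univ_three, map_add, map_sub, map_mul, map_pow, MvPolynomial.bind₁_X_right,
      MvPolynomial.algHom_C, MvPolynomial.algebraMap_eq, Units.val_mk0, hD]
    simp only [show (MvPolynomial.C 9 : MvPolynomial (Fin 3) F) = 9 from map_ofNat _ 9,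
      show (MvPolynomial.C 27 : MvPolynomial (Fin 3) F) = 27 from map_ofNat _ 27,
      show (MvPolynomial.C 3 : MvPolynomial (Fin 3) F) = 3 from map_ofNat _ 3, map_mul, map_neg,
      map_pow, map_zero, map_one, Matrix.of_apply, Matrix.cons_val', Matrix.cons_val]
    ring
  · change (!![0, -1, 0; u, 1, 9 * v; -3, 0, -u ^ 2] : Matrix (Fin 3) (Fin 3) F).mulVec _ = _
    ext i
    fin_cases i <;> simp [Matrix.mulVec, dotProduct, Fin.sum_univ_three]

/-- If an invertible linear change of coordinates fixing `(0 : 1 : 0)` relates two Weierstrass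
cubics, then an admissible change of variables relates the two Weierstrass equations. -/
theorem exists_variableChange_of_linSubst {F : Type*} [Field F] (W W' : WeierstrassCurve F)
    (N : Matrix (Fin 3) (Fin 3) F) (k d : F) (hk : k ≠ 0) (hd : d ≠ 0)
    (h : linSubst N (WeierstrassCurve.Projective.polynomial W.toProjective)
      = MvPolynomial.C k * WeierstrassCurve.Projective.polynomial W'.toProjective)
    (hN : N.mulVec ![0, 1, 0] = d • ![0, 1, 0]) :
    ∃ C : WeierstrassCurve.VariableChange F, C • W = W' := by
  have e0 : N 0 1 = 0 := by simpa [Matrix.mulVec, dotProduct, Fin.sum_univ_three] using congrFun hN 0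
  have e1 : N 1 1 = d := by simpa [Matrix.mulVec, dotProduct, Fin.sum_univ_three] using congrFun hN 1
  have e2 : N 2 1 = 0 := by simpa [Matrix.mulVec, dotProduct, Fin.sum_univ_three] using congrFun hN 2
  obtain ⟨a, ha⟩ : ∃ a, N 0 0 = a := ⟨_, rfl⟩
  obtain ⟨b, hb⟩ : ∃ b, N 0 2 = b := ⟨_, rfl⟩
  obtain ⟨e, he⟩ : ∃ e, N 1 0 = e := ⟨_, rfl⟩
  obtain ⟨f, hf⟩ : ∃ f, N 1 2 = f := ⟨_, rfl⟩
  obtain ⟨g, hg⟩ : ∃ g, N 2 0 = g := ⟨_, rfl⟩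
  obtain ⟨m, hm⟩ : ∃ m, N 2 2 = m := ⟨_, rfl⟩
  obtain ⟨a₁, a₂, a₃, a₄, a₆⟩ := W
  obtain ⟨b₁, b₂, b₃, b₄, b₆⟩ := W'
  have key := congrArg (MvPolynomial.aeval
    ![(Polynomial.X : Polynomial F), Polynomial.X ^ 4, 1]) h
  simp only [linSubst, WeierstrassCurve.Projective.polynomial, Fin.sum_univ_three, map_add, map_sub,
    map_mul, map_pow, MvPolynomial.bind₁_X_right, MvPolynomial.algHom_C,
    MvPolynomial.algebraMap_eq, MvPolynomial.aeval_X, e0, e1, e2, ha, hb, he,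
    hf, hg, hm, Matrix.cons_val, Polynomial.algebraMap_eq, Polynomial.C_0] at key
  have expand :
      Polynomial.C (d ^ 2 * g) * Polynomial.X ^ 9
      + Polynomial.C (d ^ 2 * m - k) * Polynomial.X ^ 8
      + Polynomial.C (g * (2 * e * d + a₁ * a * d + a₃ * d * g)) * Polynomial.X ^ 6
      + Polynomial.C (2 * d * (f * g + e * m) + a₁ * d * (a * m + b * g) + 2 * a₃ * d * g * m
          - k * b₁) * Polynomial.X ^ 5
      + Polynomial.C (2 * d * f * m + a₁ * b * d * m + a₃ * d * m ^ 2 - k * b₃) * Polynomial.X ^ 4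
      + Polynomial.C (e ^ 2 * g + a₁ * a * e * g + a₃ * e * g ^ 2 - a ^ 3 - a₂ * a ^ 2 * g
          - a₄ * a * g ^ 2 - a₆ * g ^ 3 + k) * Polynomial.X ^ 3
      + Polynomial.C (e ^ 2 * m + 2 * e * f * g + a₁ * (a * e * m + a * f * g + b * e * g)
          + a₃ * (2 * e * g * m + f * g ^ 2) - 3 * a ^ 2 * b - a₂ * (a ^ 2 * m + 2 * a * b * g)
          - a₄ * (2 * a * g * m + b * g ^ 2) - 3 * a₆ * g ^ 2 * m + k * b₂) * Polynomial.X ^ 2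
      + Polynomial.C (2 * e * f * m + f ^ 2 * g + a₁ * (a * f * m + b * e * m + b * f * g)
          + a₃ * (e * m ^ 2 + 2 * f * g * m) - 3 * a * b ^ 2 - a₂ * (2 * a * b * m + b ^ 2 * g)
          - a₄ * (a * m ^ 2 + 2 * b * g * m) - 3 * a₆ * g * m ^ 2 + k * b₄) * Polynomial.X
      + Polynomial.C (f ^ 2 * m + a₁ * b * f * m + a₃ * f * m ^ 2 - b ^ 3 - a₂ * b ^ 2 * m
          - a₄ * b * m ^ 2 - a₆ * m ^ 3 + k * b₆) = 0 := by
    simp only [map_add, map_sub, map_mul, map_pow, map_ofNat]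
    linear_combination key
  have coef := fun n => congrArg (fun p => Polynomial.coeff p n) expand
  have c9 := coef 9
  have c8 := coef 8
  have c5 := coef 5
  have c4 := coef 4
  have c3 := coef 3
  have c2 := coef 2
  have c1 := coef 1
  have c0 := coef 0
  clear coef expand key h hN
  simp only [Polynomial.coeff_add, Polynomial.coeff_C_mul, Polynomial.coeff_X_pow,
    Polynomial.coeff_X, Polynomial.coeff_C, Polynomial.coeff_zero] at c9 c8 c5 c4 c3 c2 c1 c0
  norm_num at c9 c8 c5 c4 c3 c2 c1 c0
  obtain rfl : g = 0 := c9.resolve_left hd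
  have hm0 : m ≠ 0 := by
    rintro rfl
    exact hk (by linear_combination -c8)
  have hk2 : k = d ^ 2 * m := by linear_combination -c8
  subst hk2
  have ha3 : a ^ 3 = d ^ 2 * m := by linear_combination -c3
  have ha0 : a ≠ 0 := by
    rintro rfl
    exact hk (by rw [← ha3]; ring)
  obtain ⟨t, rfl⟩ : ∃ t, d = t * a := ⟨d / a, by field_simp⟩
  have ht : t ≠ 0 := left_ne_zero_of_mul hd
  obtain rfl : a = t ^ 2 * m := mul_left_cancel₀ (pow_ne_zero 2 ha0) (by linear_combination ha3)
  obtain ⟨r, rfl⟩ : ∃ r, b = r * m := ⟨b / m, by field_simp⟩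
  obtain ⟨s, rfl⟩ : ∃ s, e = s * (t ^ 2 * m) := ⟨e / (t ^ 2 * m), by field_simp⟩
  obtain ⟨w, rfl⟩ : ∃ w, f = w * m := ⟨f / m, by field_simp⟩
  refine ⟨⟨Units.mk0 t ht, r, s, w⟩, ?_⟩
  have hm3 : m ^ 3 ≠ 0 := pow_ne_zero 3 hm0
  rw [WeierstrassCurve.variableChange_def]
  ext <;> simp only [Units.val_inv_eq_inv_val, Units.val_mk0, inv_pow] <;>
    rw [inv_mul_eq_iff_eq_mul₀ (by positivity)] <;> apply mul_left_cancel₀ hm3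
  · apply mul_left_cancel₀ (pow_ne_zero 5 ht)
    linear_combination c5
  · apply mul_left_cancel₀ (pow_ne_zero 4 ht)
    linear_combination -c2
  · apply mul_left_cancel₀ (pow_ne_zero 3 ht)
    linear_combination c4
  · apply mul_left_cancel₀ (pow_ne_zero 2 ht)
    linear_combination -c1
  · linear_combination -c0

/-- A Weierstrass equation of a generalized Hessian curve is unique up to an admissible change of
variables. -/
theorem IsWeierstrassModel.exists_variableChange {F : Type*} [Field F] {E : GHCurve F}
    {W W' : WeierstrassCurve F} (h : IsWeierstrassModel E W) (h' : IsWeierstrassModel E W') :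
    ∃ C : WeierstrassCurve.VariableChange F, C • W = W' := by
  obtain ⟨M, c, d, hM, hO⟩ := h
  obtain ⟨M', c', d', hM', hO'⟩ := h'
  have hMM : (M⁻¹).val * M.val = 1 := by rw [← Units.val_mul, inv_mul_cancel, Units.val_one]
  have hMM2 : M.val * (M⁻¹).val = 1 := by rw [← Units.val_mul, mul_inv_cancel, Units.val_one]
  refine exists_variableChange_of_linSubst W W' ((M⁻¹).val * M'.val) (c' / c) (d' / d)
    (by simp) (by simp) ?_ ?_
  · have h1 := congrArg (linSubst ((M⁻¹).val * M'.val)) hM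
    rw [linSubst_mul, ← mul_assoc, hMM2, one_mul, hM'] at h1
    have h2 : ∀ G, linSubst ((M⁻¹).val * M'.val) (MvPolynomial.C (c : F) * G)
        = MvPolynomial.C (c : F) * linSubst ((M⁻¹).val * M'.val) G := fun G => by
      simp [linSubst]
    rw [h2] at h1
    have hc : (MvPolynomial.C (c : F) : MvPolynomial (Fin 3) F) ≠ 0 := by simp
    apply mul_left_cancel₀ hc
    rw [← h1, ← mul_assoc, ← MvPolynomial.C_mul, mul_div_cancel₀ _ c.ne_zero]
  · have h1 : (![1, -1, 0] : Fin 3 → F) = (d : F)⁻¹ • M.val.mulVec ![0, 1, 0] := by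
      rw [hO, smul_smul, inv_mul_cancel₀ d.ne_zero, one_smul]
    rw [← Matrix.mulVec_mulVec, hO', h1, Matrix.mulVec_smul, Matrix.mulVec_smul,
      Matrix.mulVec_mulVec, hMM, Matrix.one_mulVec, smul_smul, div_eq_mul_inv]

/-- Isomorphism over `F`, as an equivalence relation on the family. -/
instance GHCurve.isoSetoid (F : Type*) [Field F] : Setoid (GHCurve F) where
  r := GHIso
  iseqv := by
    refine ⟨fun E => ?_, fun {E E'} h => ?_, fun {E E' E''} h h' => ?_⟩
    · exact ⟨_, _, ghWeierstrass_isWeierstrassModel E, ghWeierstrass_isWeierstrassModel E, 1,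
        one_smul _ _⟩
    · obtain ⟨W, W', hW, hW', C, hC⟩ := h
      exact ⟨W', W, hW', hW, C⁻¹, by rw [← hC, inv_smul_smul]⟩
    · obtain ⟨W, W', hW, hW', C, hC⟩ := h
      obtain ⟨V, V', hV, hV', D, hD⟩ := h'
      obtain ⟨B, hB⟩ := hW'.exists_variableChange hV
      exact ⟨W, V', hW, hV', D * (B * C), by rw [mul_smul, mul_smul, hC, hB, hD]⟩

/-- The number of `F`-isomorphism classes of generalized Hessian curves over `F`. -/
noncomputable def numIsoGH (F : Type*) [Field F] : ℕ :=
  Nat.card (Quotient (GHCurve.isoSetoid F))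

/-- The number of distinct `j`-invariants of generalized Hessian curves over `F`. -/
noncomputable def numJGH (F : Type*) [Field F] : ℕ :=
  Set.ncard {a : F | ∃ (E : GHCurve F) (W : WeierstrassCurve F) (_ : W.IsElliptic),
    IsWeierstrassModel E W ∧ W.j = a}

/-! Isomorphism can be tested on the explicit models `ghWeierstrass`, since a Weierstrass model is
unique up to an admissible change. Rescaling identifies `(u, v)` with `(t u, t³ v)`, so the classes
are governed by how far `v` is from a cube.

If `q` is not `1` modulo `3`, cubing is bijective. In characteristic 3 one normalizes `u = 1`, and
`j = 1 / v` separates the curves. Otherwise one normalizes `v = 1`, `u = 3 d` with `d ≠ 1`, and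
`eq_of_ghIso_hesse` shows that distinct `d` are never isomorphic: a coincidence of invariants would
produce a primitive cube root of unity. Both families have `q - 1` members.

If `q ≡ 1` modulo `3`, a primitive cube root of unity `w` makes the Hesse pencil transformations
rational. They show that a nonzero `j` determines the class (`ghIso_of_ghJ_eq`). Every curve with `j
= 0` can be brought to `u = 0`, where the class of `v` modulo cubes leaves exactly three isomorphism
classes. Hence `I = J + 2`.

To count `j`-invariants, write `j = 27 s (s + 8)³ / (s - 1)³` with `s = u³ / (27 v)`. Non-cubes `s`
give distinct values, disjoint from those of cubes (`exists_cube_of_hesseJ_eq`). For `s = d³`, `j`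
is the cube of `hesseGamma d`, a degree 4 function whose fibres are orbits of a Klein four-group of
involutions. These orbits have four elements except over `j = 1728`. -/

/-! ### Reduction to explicit models and their invariants -/

theorem ghIso_iff {F : Type*} [Field F] {E E' : GHCurve F} :
    GHIso E E' ↔ ∃ C : WeierstrassCurve.VariableChange F,
      C • ghWeierstrass E = ghWeierstrass E' := by
  constructor
  · rintro ⟨W, W', hW, hW', C, hC⟩
    obtain ⟨A, hA⟩ := (ghWeierstrass_isWeierstrassModel E).exists_variableChange hW
    obtain ⟨B, hB⟩ := hW'.exists_variableChange (ghWeierstrass_isWeierstrassModel E')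
    exact ⟨B * (C * A), by rw [mul_smul, mul_smul, hA, hC, hB]⟩
  · rintro ⟨C, hC⟩
    exact ⟨_, _, ghWeierstrass_isWeierstrassModel E, ghWeierstrass_isWeierstrassModel E', C, hC⟩

theorem ghIso_trans {F : Type*} [Field F] {E E' E'' : GHCurve F} (h : GHIso E E')
    (h' : GHIso E' E'') : GHIso E E'' :=
  (GHCurve.isoSetoid F).iseqv.trans h h'

theorem ghIso_symm {F : Type*} [Field F] {E E' : GHCurve F} (h : GHIso E E') : GHIso E' E :=
  (GHCurve.isoSetoid F).iseqv.symm h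

theorem ghIso_of_scale {F : Type*} [Field F] {E E' : GHCurve F} {t : F} (ht : t ≠ 0)
    (hu : E'.u = t * E.u) (hv : E'.v = t ^ 3 * E.v) : GHIso E E' := by
  refine ghIso_iff.2 ⟨⟨(Units.mk0 t ht)⁻¹, 0, 0, 0⟩, ?_⟩
  rw [WeierstrassCurve.variableChange_def]
  ext <;> simp [ghWeierstrass, hu, hv] <;> ring

theorem ghWeierstrass_c₄ {F : Type*} [Field F] (E : GHCurve F) :
    (ghWeierstrass E).c₄ = E.u * (E.u ^ 3 + 216 * E.v) := by
  simp only [ghWeierstrass, WeierstrassCurve.c₄, WeierstrassCurve.b₂, WeierstrassCurve.b₄]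
  ring

theorem ghWeierstrass_c₆ {F : Type*} [Field F] (E : GHCurve F) :
    (ghWeierstrass E).c₆ = -E.u ^ 6 + 540 * E.u ^ 3 * E.v + 5832 * E.v ^ 2 := by
  simp only [ghWeierstrass, WeierstrassCurve.c₆, WeierstrassCurve.b₂, WeierstrassCurve.b₄,
    WeierstrassCurve.b₆]
  ring

theorem ghWeierstrass_Δ {F : Type*} [Field F] (E : GHCurve F) :
    (ghWeierstrass E).Δ = E.v * (E.u ^ 3 - 27 * E.v) ^ 3 := by
  simp only [ghWeierstrass, WeierstrassCurve.Δ, WeierstrassCurve.b₂, WeierstrassCurve.b₄,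
    WeierstrassCurve.b₆, WeierstrassCurve.b₈]
  ring

theorem ghWeierstrass_Δ_ne_zero {F : Type*} [Field F] (E : GHCurve F) :
    (ghWeierstrass E).Δ ≠ 0 := by
  rw [ghWeierstrass_Δ]
  exact mul_ne_zero E.v_ne_zero (pow_ne_zero _ (sub_ne_zero.2 E.nonsingular))

instance {F : Type*} [Field F] (E : GHCurve F) : (ghWeierstrass E).IsElliptic :=
  ⟨(ghWeierstrass_Δ_ne_zero E).isUnit⟩

/-- The `j`-invariant of a generalized Hessian curve. -/
noncomputable def ghJ {F : Type*} [Field F] (E : GHCurve F) : F :=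
  (E.u * (E.u ^ 3 + 216 * E.v)) ^ 3 / (E.v * (E.u ^ 3 - 27 * E.v) ^ 3)

theorem ghWeierstrass_j {F : Type*} [Field F] (E : GHCurve F) : (ghWeierstrass E).j = ghJ E := by
  rw [WeierstrassCurve.j, ghWeierstrass_c₄, Units.val_inv_eq_inv_val, WeierstrassCurve.coe_Δ',
    ghWeierstrass_Δ, ghJ, div_eq_inv_mul]

theorem exists_of_ghIso {F : Type*} [Field F] {E E' : GHCurve F} (h : GHIso E E') :
    ∃ t : F, t ≠ 0 ∧ (ghWeierstrass E).c₄ = t ^ 4 * (ghWeierstrass E').c₄ ∧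
      (ghWeierstrass E).c₆ = t ^ 6 * (ghWeierstrass E').c₆ ∧
      (ghWeierstrass E).Δ = t ^ 12 * (ghWeierstrass E').Δ := by
  obtain ⟨C, hC⟩ := ghIso_iff.1 h
  refine ⟨C.u, C.u.ne_zero, ?_, ?_, ?_⟩
  · rw [← hC, WeierstrassCurve.variableChange_c₄, ← mul_assoc, ← mul_pow]; simp
  · rw [← hC, WeierstrassCurve.variableChange_c₆, ← mul_assoc, ← mul_pow]; simp
  · rw [← hC, WeierstrassCurve.variableChange_Δ, ← mul_assoc, ← mul_pow]; simp

theorem ghJ_eq_of_ghIso {F : Type*} [Field F] {E E' : GHCurve F} (h : GHIso E E') :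
    ghJ E = ghJ E' := by
  obtain ⟨C, hC⟩ := ghIso_iff.1 h
  rw [← ghWeierstrass_j, ← ghWeierstrass_j]
  simp_rw [← hC]
  exact (WeierstrassCurve.variableChange_j _ C).symm

theorem numJGH_eq_ncard_range {F : Type*} [Field F] :
    numJGH F = (Set.range (ghJ : GHCurve F → F)).ncard := by
  unfold numJGH
  congr 1
  ext a
  constructor
  · rintro ⟨E, W, hW, hEW, rfl⟩
    obtain ⟨C, rfl⟩ := (ghWeierstrass_isWeierstrassModel E).exists_variableChange hEW
    exact ⟨E, by rw [WeierstrassCurve.variableChange_j, ghWeierstrass_j]⟩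
  · rintro ⟨E, rfl⟩
    exact ⟨E, _, inferInstance, ghWeierstrass_isWeierstrassModel E, ghWeierstrass_j E⟩

/-! ### Isomorphisms from linear substitutions -/

/-- Composing the substitution with the one defining the model of `E'` makes that same Weierstrass
equation a model of `E` as well. -/
theorem ghIso_of_linSubst {F : Type*} [Field F] {E E' : GHCurve F}
    (M : Matrix (Fin 3) (Fin 3) F) {k d : F} (hM : M.det ≠ 0) (hk : k ≠ 0) (hd : d ≠ 0)
    (h : linSubst M (ghPolynomial E.u E.v) = MvPolynomial.C k * ghPolynomial E'.u E'.v)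
    (hO : M.mulVec ![1, -1, 0] = d • ![1, -1, 0]) : GHIso E E' := by
  obtain ⟨N, c, e, hN, hNO⟩ := ghWeierstrass_isWeierstrassModel E'
  refine ⟨_, _, ⟨Matrix.GeneralLinearGroup.mkOfDetNeZero M hM * N, Units.mk0 k hk * c,
    e * Units.mk0 d hd, ?_, ?_⟩, ghWeierstrass_isWeierstrassModel E', 1, one_smul _ _⟩
  · change linSubst (M * N.val) _ = _
    rw [← linSubst_mul, h]
    have : linSubst N.val (MvPolynomial.C k * ghPolynomial E'.u E'.v)
        = MvPolynomial.C k * linSubst N.val (ghPolynomial E'.u E'.v) := by simp [linSubst]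
    rw [this, hN, ← mul_assoc, ← MvPolynomial.C_mul]
    rfl
  · change (M * N.val).mulVec _ = _
    rw [← Matrix.mulVec_mulVec, hNO, Matrix.mulVec_smul, hO, smul_smul]
    rfl

/-- The Hesse pencil transformation attached to a primitive cube root of unity. -/
theorem ghIso_of_hesse {F : Type*} [Field F] {E E' : GHCurve F} {w : F} (hw : w ^ 2 + w + 1 = 0)
    (h3 : (3 : F) ≠ 0) (hE : E.v = 1) (hE' : E'.v = 1)
    (h : E'.u * (w * E.u - 3) = 3 * (w * E.u + 6)) : GHIso E E' := by
  have hw3 : w ^ 3 = 1 := by linear_combination (w - 1) * hw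
  have hw1 : w ≠ 1 := by rintro rfl; exact h3 (by linear_combination hw)
  have hk : 3 - w * E.u ≠ 0 := by
    intro h0
    apply E.nonsingular
    rw [hE]
    linear_combination (-w ^ 2 * E.u ^ 2 - 3 * w * E.u - 9) * h0 - E.u ^ 3 * hw3
  -- A Fourier matrix for the cube roots of unity, with its rows arranged and scaled so that the
  -- flex `(1 : -1 : 0)` stays fixed.
  refine ghIso_of_linSubst !![1, w, w ^ 2; w, 1, w ^ 2; 1, 1, 1] (k := 3 - w * E.u) (d := 1 - w)
    ?_ hk (sub_ne_zero.2 hw1.symm) ?_ ?_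
  · have : (!![1, w, w ^ 2; w, 1, w ^ 2; 1, 1, 1] : Matrix (Fin 3) (Fin 3) F).det
        = 3 * (1 - w ^ 2) := by
      rw [Matrix.det_fin_three]
      simp
      linear_combination (2 * w - 2) * hw
    rw [this]
    refine mul_ne_zero h3 fun h0 => hw1 ?_
    linear_combination w * h0 + hw3
  · obtain ⟨u, v, h1, h2⟩ := E
    obtain ⟨u', v', h1', h2'⟩ := E'
    simp only at hE hE' h hk ⊢
    subst hE hE'
    have hC : (MvPolynomial.C w ^ 2 + MvPolynomial.C w + 1 : MvPolynomial (Fin 3) F) = 0 := by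
      rw [← map_pow, ← map_add, ← map_one MvPolynomial.C, ← map_add, hw, map_zero]
    have hC2 := congrArg (MvPolynomial.C : F → MvPolynomial (Fin 3) F) h
    have e3 : (MvPolynomial.C 3 : MvPolynomial (Fin 3) F) = 3 := map_ofNat _ 3
    have e6 : (MvPolynomial.C 6 : MvPolynomial (Fin 3) F) = 6 := map_ofNat _ 6
    simp only [map_mul, map_sub, map_add, e3, e6] at hC2
    simp only [linSubst, ghPolynomial,
      Fin.sum_univ_three, map_add, map_sub, map_mul, map_pow, MvPolynomial.bind₁_X_right,
      MvPolynomial.algHom_C, MvPolynomial.algebraMap_eq, e3, map_one, Matrix.of_apply,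
      Matrix.cons_val', Matrix.cons_val]
    generalize (MvPolynomial.C w : MvPolynomial (Fin 3) F) = ω at *
    generalize (MvPolynomial.C u : MvPolynomial (Fin 3) F) = U at *
    generalize (MvPolynomial.C u' : MvPolynomial (Fin 3) F) = U' at *
    generalize (MvPolynomial.X 0 : MvPolynomial (Fin 3) F) = x at *
    generalize (MvPolynomial.X 1 : MvPolynomial (Fin 3) F) = y at *
    generalize (MvPolynomial.X 2 : MvPolynomial (Fin 3) F) = z at *
    clear h hw hw3 hw1 hk e3 e6 h1 h2 h1' h2'
    grind
  · ext i
    fin_cases i <;> simp [Matrix.mulVec, dotProduct, Fin.sum_univ_three, sub_eq_add_neg]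

/-! ### The case where cubing is bijective -/

theorem three_eq_zero_iff {F : Type*} [Field F] [Finite F] : (3 : F) = 0 ↔ 3 ∣ Nat.card F := by
  have := Fintype.ofFinite F
  have : Fact (Nat.Prime 3) := ⟨Nat.prime_three⟩
  rw [Nat.card_eq_fintype_card, ← prime_dvd_char_iff_dvd_card (R := F) 3]
  have h : ((3 : ℕ) : F) = 0 ↔ ringChar F ∣ 3 := ringChar.spec F 3
  have hp : (ringChar F).Prime := CharP.prime_ringChar F
  rw [show (3 : F) = ((3 : ℕ) : F) by norm_num, h, Nat.prime_dvd_prime_iff_eq hp Nat.prime_three,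
    Nat.prime_dvd_prime_iff_eq Nat.prime_three hp, eq_comm]

theorem cube_bijective {F : Type*} [Field F] [Finite F] (h : ¬ Nat.card F ≡ 1 [MOD 3]) :
    Function.Bijective (fun x : F => x ^ 3) := by
  have := Fintype.ofFinite F
  have hq : ∀ x : F, x ^ Nat.card F = x := fun x => by
    rw [Nat.card_eq_fintype_card, FiniteField.pow_card]
  have hq1 : 1 < Nat.card F := Finite.one_lt_card
  obtain ⟨k, hk⟩ : ∃ k, ∀ x : F, (x ^ 3) ^ k = x := by
    generalize Nat.card F = q at *
    have : q % 3 = 0 ∨ q % 3 = 2 := by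
      have : ¬ q % 3 = 1 := h
      omega
    rcases this with h | h
    · obtain ⟨k, rfl⟩ := Nat.dvd_of_mod_eq_zero h
      exact ⟨k, fun x => by rw [← pow_mul, hq]⟩
    -- Since `2 q - 1 = 1 + 2 (q - 1)` is divisible by 3, this exponent inverts 3 modulo `q - 1`.
    · refine ⟨(2 * q - 1) / 3, fun x => ?_⟩
      rw [← pow_mul, show 3 * ((2 * q - 1) / 3) = q + (q - 1) by omega, pow_add, hq, ← pow_succ',
        show q - 1 + 1 = q by omega, hq]
  exact ⟨fun x y hxy => by rw [← hk x, ← hk y]; exact congrArg (· ^ k) hxy,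
    fun x => ⟨x ^ k, by simp only; rw [← pow_mul, mul_comm, pow_mul, hk]⟩⟩

theorem no_cube_root_of_unity {F : Type*} [Field F]
    (hc : Function.Injective (fun x : F => x ^ 3)) (h3 : (3 : F) ≠ 0) (w : F) :
    w ^ 2 + w + 1 ≠ 0 := by
  intro hw
  have : w = 1 := hc (by simp only; linear_combination (w - 1) * hw)
  subst this
  exact h3 (by linear_combination hw)

/-- A square root `z` of `-3` would give the primitive cube root of unity `(z - 1) / 2`. -/
theorem neg_three_not_square {F : Type*} [Field F]
    (hc : Function.Injective (fun x : F => x ^ 3)) (h3 : (3 : F) ≠ 0) (h2 : (2 : F) ≠ 0) (z : F) :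
    z ^ 2 ≠ -3 := by
  intro hz
  apply no_cube_root_of_unity hc h3 ((z - 1) / 2)
  field_simp
  linear_combination hz

/-- In the family with `v = 1`, the cubic invariant `c₄³ / Δ` has the rational cube root
`3 d (d³ + 8) / (d³ - 1)`, whose fibres are described by this factorization. -/
theorem hesse_invariant_factor {F : Type*} [Field F] {a b : F}
    (h : a * (a ^ 3 + 8) * (b ^ 3 - 1) = b * (b ^ 3 + 8) * (a ^ 3 - 1)) :
    a = b ∨ a * b = a + b + 2 ∨
      (a * b + 2) ^ 2 + (a * b + 2) * (a + b - 2) + (a + b - 2) ^ 2 = 0 := by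
  have : (a - b) * ((a * b - (a + b + 2)) *
      ((a * b + 2) ^ 2 + (a * b + 2) * (a + b - 2) + (a + b - 2) ^ 2)) = 0 := by
    linear_combination h
  rcases mul_eq_zero.1 this with h | h
  · exact Or.inl (sub_eq_zero.1 h)
  · rcases mul_eq_zero.1 h with h | h
    · exact Or.inr (Or.inl (sub_eq_zero.1 h))
    · exact Or.inr (Or.inr h)

/-- The form divides `x³ - y³`, so its vanishing forces `x = y`, and then `3 x² = 0`. -/
theorem eq_zero_of_norm_eq_zero {F : Type*} [Field F]
    (hc : Function.Injective (fun x : F => x ^ 3)) (h3 : (3 : F) ≠ 0) {x y : F}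
    (h : x ^ 2 + x * y + y ^ 2 = 0) : x = 0 ∧ y = 0 := by
  have : x = y := hc (by simp only; linear_combination (x - y) * h)
  subst this
  have : 3 * x ^ 2 = 0 := by linear_combination h
  have : x = 0 := by simpa [h3] using this
  exact ⟨this, this⟩

/-- The discriminants are cubes, so injectivity of cubing extracts `a³ - 1 = t⁴ (b³ - 1)`. Together
with `c₄` this yields the factorization of `hesse_invariant_factor`. Each factor other than `a = b`
is then excluded, using `c₆` or, in characteristic 2, the coefficients of the change of variables.
-/
theorem eq_of_ghIso_hesse {F : Type*} [Field F]
    (hc : Function.Injective (fun x : F => x ^ 3)) (h3 : (3 : F) ≠ 0) {E E' : GHCurve F} {a b : F}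
    (hE : E.v = 1) (hE' : E'.v = 1) (hu : E.u = 3 * a) (hu' : E'.u = 3 * b) (h : GHIso E E') :
    a = b := by
  obtain ⟨t, ht, h4, h6, hΔ⟩ := exists_of_ghIso h
  rw [ghWeierstrass_c₄, ghWeierstrass_c₄, hE, hE', hu, hu'] at h4
  rw [ghWeierstrass_c₆, ghWeierstrass_c₆, hE, hE', hu, hu'] at h6
  rw [ghWeierstrass_Δ, ghWeierstrass_Δ, hE, hE', hu, hu'] at hΔ
  have h27 : (27 : F) ≠ 0 := by
    rw [show (27 : F) = 3 ^ 3 by norm_num]; exact pow_ne_zero _ h3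
  have h81 : (81 : F) ≠ 0 := by
    rw [show (81 : F) = 3 ^ 4 by norm_num]; exact pow_ne_zero _ h3
  have h729 : (729 : F) ≠ 0 := by
    rw [show (729 : F) = 3 ^ 6 by norm_num]; exact pow_ne_zero _ h3
  have hd : a ^ 3 - 1 = t ^ 4 * (b ^ 3 - 1) := by
    have : 27 * (a ^ 3 - 1) = t ^ 4 * (27 * (b ^ 3 - 1)) :=
      hc (by simp only; linear_combination hΔ)
    exact mul_left_cancel₀ h27 (by linear_combination this)
  have hg : a * (a ^ 3 + 8) = t ^ 4 * (b * (b ^ 3 + 8)) :=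
    mul_left_cancel₀ h81 (by linear_combination h4)
  have hh : a ^ 6 - 20 * a ^ 3 - 8 = t ^ 6 * (b ^ 6 - 20 * b ^ 3 - 8) :=
    mul_left_cancel₀ h729 (by linear_combination -h6)
  have ha : a ^ 3 - 1 ≠ 0 := fun h0 => E.nonsingular (by
    rw [hE, hu]; linear_combination 27 * h0)
  have hb : b ^ 3 - 1 ≠ 0 := fun h0 => E'.nonsingular (by
    rw [hE', hu']; linear_combination 27 * h0)
  have ha1 : a - 1 ≠ 0 := fun h0 => ha (by linear_combination (a ^ 2 + a + 1) * h0)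
  have ha2 := no_cube_root_of_unity hc h3 a
  by_contra hab
  rcases (hesse_invariant_factor (a := a) (b := b)
    (by linear_combination (b ^ 3 - 1) * hg - b * (b ^ 3 + 8) * hd)).resolve_left hab with hp | hp
  · have hbe : b = (a + 2) / (a - 1) := by
      rw [eq_div_iff ha1]; linear_combination hp
    -- For `b = (a + 2) / (a - 1)` the scaling factor is known up to sign: `3 t² = ± (a - 1)²`.
    -- Outside characteristic 2 the minus sign would make `-3` a square.
    have hT : (t ^ 2 * 3) ^ 2 = ((a - 1) ^ 2) ^ 2 := by
      have e : (a - 1) ^ 3 * (b ^ 3 - 1) = 9 * (a ^ 2 + a + 1) := by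
        rw [hbe]; field_simp; ring
      apply mul_left_cancel₀ ha2
      linear_combination (-(a - 1) ^ 3) * hd - t ^ 4 * e
    have hminus : t ^ 2 * 3 ≠ -(a - 1) ^ 2 ∨ (2 : F) = 0 := by
      by_cases h2 : (2 : F) = 0
      · exact Or.inr h2
      refine Or.inl fun h0 => neg_three_not_square hc h3 h2 ((a - 1) / t) ?_
      field_simp
      linear_combination h0
    -- In characteristic 2 signs carry no information, so `a₁`, `a₂`, `a₃` are compared directly.
    by_cases h2 : (2 : F) = 0
    · obtain ⟨C, hC⟩ := ghIso_iff.1 h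
      rw [WeierstrassCurve.variableChange_def] at hC
      have e1 := congrArg WeierstrassCurve.a₁ hC
      have e2 := congrArg WeierstrassCurve.a₂ hC
      have e3 := congrArg WeierstrassCurve.a₃ hC
      simp only [ghWeierstrass, hE, hE', hu, hu', Units.val_inv_eq_inv_val, inv_pow] at e1 e2 e3
      rw [inv_mul_eq_iff_eq_mul₀ (by simp)] at e1 e2 e3
      set τ : F := (C.u : F)
      have hτ : τ ≠ 0 := C.u.ne_zero
      have hat : a = τ * b := by linear_combination e1 - (a - τ * b + C.s) * h2
      have hb0 : b ≠ 0 := by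
        rintro rfl
        exact hab (by rw [hat, mul_zero])
      have ha0 : a ≠ 0 := by rw [hat]; exact mul_ne_zero hτ hb0
      have hτa : τ = a - 1 := mul_left_cancel₀ hb0 (by linear_combination hp - hat + (a + 1 + b - b * a) * h2)
      have hr : C.r = a ^ 2 + a + 1 := mul_left_cancel₀ ha0 (by
        rw [hτa] at e3
        linear_combination e3 + ((a - 1) ^ 3 * 4 - 4 - C.t - C.r * a  - 2 * a ^ 2 + a - 1) * h2)
      -- With `r = a² + a + 1`, the `a₂` equation reads `s² + a s + a² + a + 1 = 0`, which says that
      -- `(s + 1) / a` is a primitive cube root of unity.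
      apply no_cube_root_of_unity hc h3 ((C.s + 1) / a)
      field_simp
      linear_combination -e2 + 3 * hr + (C.s - C.s * a + 2 * (a ^ 2 + a + 1)) * h2
    · have hplus : t ^ 2 * 3 = (a - 1) ^ 2 := by
        rcases sq_eq_sq_iff_eq_or_eq_neg.1 hT with h0 | h0
        · exact h0
        · exact absurd h0 (hminus.resolve_right h2)
      -- The involution reverses the sign of `c₆` relative to `27 t⁶ = (a - 1)⁶`, so `c₆` must
      -- vanish.
      have e : (a - 1) ^ 6 * (b ^ 6 - 20 * b ^ 3 - 8) = -27 * (a ^ 6 - 20 * a ^ 3 - 8) := by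
        rw [hbe]; field_simp; ring
      have hz : a ^ 6 - 20 * a ^ 3 - 8 = 0 := by
        have : 2 * (a ^ 6 - 20 * a ^ 3 - 8) = 0 := by
          apply mul_left_cancel₀ h27
          have : 27 * t ^ 6 = (a - 1) ^ 6 := by
            linear_combination (9 * t ^ 4 + 3 * t ^ 2 * (a - 1) ^ 2 + (a - 1) ^ 4) * hplus
          linear_combination 27 * hh + (b ^ 6 - 20 * b ^ 3 - 8) * this + e
        exact (mul_eq_zero.1 this).resolve_left h2
      -- The first factor is the fixed-point equation of `a ↦ (a + 2) / (a - 1)`, giving `a = b`;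
      -- the second is an anisotropic norm form.
      have hz2 : (a ^ 2 - 2 * a - 2) *
          ((a ^ 2 + 2) ^ 2 + (a ^ 2 + 2) * (2 * a - 2) + (2 * a - 2) ^ 2) = 0 := by
        linear_combination hz
      rcases mul_eq_zero.1 hz2 with h0 | h0
      · exact hab (mul_right_cancel₀ ha1 (by linear_combination h0 - hp))
      · obtain ⟨h5, h6⟩ := eq_zero_of_norm_eq_zero hc h3 h0
        have : a = 1 := mul_left_cancel₀ h2 (by linear_combination h6)
        exact ha1 (sub_eq_zero.2 this)
  -- Here `a + b = 2` and `a b = -2`, and the scaling relation again exhibits `-3` as a square.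
  · obtain ⟨hx, hy⟩ := eq_zero_of_norm_eq_zero hc h3 hp
    obtain rfl : b = 2 - a := by linear_combination hy
    have hq : a ^ 2 = 2 * a + 2 := by linear_combination -hx
    have h2 : (2 : F) ≠ 0 := fun h2 => hab (by linear_combination (a - 1) * h2)
    have h6 : 6 * a + 3 ≠ 0 := fun h0 => ha (by linear_combination h0 + (a + 2) * hq)
    have hd' : 6 * a + 3 = t ^ 4 * (15 - 6 * a) := by
      linear_combination hd + (t ^ 4 * (4 - a) - a - 2) * hq
    have h108 : (6 * a + 3) ^ 2 = -27 * t ^ 4 := by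
      linear_combination (6 * a + 3) * hd' - 36 * t ^ 4 * hq
    apply neg_three_not_square hc h3 h2 (9 * t ^ 2 / (6 * a + 3))
    field_simp
    linear_combination 3 * h108

theorem numIsoGH_of_cube_bijective {F : Type*} [Field F] [Finite F]
    (hc : Function.Bijective (fun x : F => x ^ 3)) : numIsoGH F = Nat.card F - 1 := by
  classical
  have := Fintype.ofFinite F
  by_cases h3 : (3 : F) = 0
  · have h27 : (27 : F) = 0 := by linear_combination 9 * h3
    have h216 : (216 : F) = 0 := by linear_combination 72 * h3
    -- In characteristic 3 nonsingularity means `u ≠ 0`, and `j = u³ / v`.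
    let f : Fˣ → Quotient (GHCurve.isoSetoid F) := fun v =>
      Quotient.mk _ ⟨1, v, v.ne_zero, by simp [h27]⟩
    have hf : Function.Bijective f := by
      constructor
      · intro v v' h
        have := ghJ_eq_of_ghIso (Quotient.exact h)
        simp only [ghJ, h27, h216] at this
        ext
        simpa using this
      · intro x
        induction x using Quotient.inductionOn with | _ E
        have hu : E.u ≠ 0 := fun h0 => E.nonsingular (by rw [h0, h27]; simp)
        refine ⟨Units.mk0 (E.v / E.u ^ 3) (div_ne_zero E.v_ne_zero (pow_ne_zero _ hu)),
          Quotient.sound (ghIso_of_scale hu ?_ ?_)⟩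
        · simp
        · simp only [Units.val_mk0]; field_simp
    rw [numIsoGH, ← Nat.card_eq_of_bijective f hf, Nat.card_eq_fintype_card,
      Fintype.card_units, Nat.card_eq_fintype_card]
  · have hne : ∀ d : {d : F // d ≠ 1}, (3 * (d : F)) ^ 3 ≠ 27 * 1 := fun d h0 => d.2 (hc.1 (by
      have h27 : (27 : F) ≠ 0 := by
        rw [show (27 : F) = 3 ^ 3 by norm_num]; exact pow_ne_zero _ h3
      exact mul_left_cancel₀ h27 (by linear_combination h0)))
    let f : {d : F // d ≠ 1} → Quotient (GHCurve.isoSetoid F) := fun d =>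
      Quotient.mk _ ⟨3 * d, 1, one_ne_zero, hne d⟩
    have hf : Function.Bijective f := by
      constructor
      · intro d d' h
        exact Subtype.ext (eq_of_ghIso_hesse hc.1 h3 rfl rfl rfl rfl (Quotient.exact h))
      · intro x
        induction x using Quotient.inductionOn with | _ E
        obtain ⟨w, hw⟩ := hc.2 E.v
        simp only at hw
        have hw0 : w ≠ 0 := by rintro rfl; exact E.v_ne_zero (by rw [← hw]; simp)
        refine ⟨⟨E.u / (3 * w), fun h0 => E.nonsingular ?_⟩,
          Quotient.sound (ghIso_of_scale hw0 ?_ ?_)⟩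
        · rw [div_eq_one_iff_eq (mul_ne_zero h3 hw0)] at h0
          rw [h0, ← hw]; ring
        · simp only; field_simp
        · simp [hw]
    rw [numIsoGH, ← Nat.card_eq_of_bijective f hf, Nat.card_eq_fintype_card,
      Fintype.card_subtype_compl, Fintype.card_subtype_eq, Nat.card_eq_fintype_card]

/-! ### Hesse isomorphisms in the presence of a primitive cube root of unity -/

/-- The curve obtained by rescaling the third projective coordinate. -/
def GHCurve.scale {F : Type*} [Field F] (E : GHCurve F) (t : F) (ht : t ≠ 0) : GHCurve F :=
  ⟨t * E.u, t ^ 3 * E.v, mul_ne_zero (pow_ne_zero _ ht) E.v_ne_zero, fun h =>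
    E.nonsingular (mul_left_cancel₀ (pow_ne_zero 3 ht) (by linear_combination h))⟩

theorem ghIso_scale {F : Type*} [Field F] (E : GHCurve F) (t : F) (ht : t ≠ 0) :
    GHIso E (E.scale t ht) :=
  ghIso_of_scale ht rfl rfl

/-- The relation says `w b = (w a + 2) / (w a - 1)`; it is the Hesse transformation followed by a
rescaling by a cube root of unity, which keeps `v = 1`. -/
theorem ghIso_of_hesse_involution {F : Type*} [Field F] {E E' : GHCurve F} {w a b : F}
    (hw : w ^ 2 + w + 1 = 0) (h3 : (3 : F) ≠ 0) (hE : E.v = 1) (hE' : E'.v = 1)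
    (hu : E.u = 3 * a) (hu' : E'.u = 3 * b) (h : b * (w * a - 1) = a + 2 * w ^ 2) :
    GHIso E E' := by
  have hw3 : w ^ 3 = 1 := by linear_combination (w - 1) * hw
  have hw0 : w ≠ 0 := by rintro rfl; simp at hw
  refine ghIso_trans (ghIso_of_hesse (E' := E'.scale w hw0) hw h3 hE ?_ ?_)
    (ghIso_symm (ghIso_scale E' w hw0))
  · simp [GHCurve.scale, hw3, hE']
  · simp only [GHCurve.scale, hu, hu']
    linear_combination 9 * w * h + 18 * hw3

/-- Once `w` is available, the norm-form factor splits into the relations for `w` and `w²`, so every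
factor is realized by an isomorphism. -/
theorem ghIso_of_hesse_invariant {F : Type*} [Field F] {E E' : GHCurve F} {w a b : F}
    (hw : w ^ 2 + w + 1 = 0) (h3 : (3 : F) ≠ 0) (hE : E.v = 1) (hE' : E'.v = 1)
    (hu : E.u = 3 * a) (hu' : E'.u = 3 * b)
    (h : a * (a ^ 3 + 8) * (b ^ 3 - 1) = b * (b ^ 3 + 8) * (a ^ 3 - 1)) : GHIso E E' := by
  have hw3 : w ^ 3 = 1 := by linear_combination (w - 1) * hw
  have hw0 : w ≠ 0 := by rintro rfl; simp at hw
  rcases hesse_invariant_factor h with h | h | h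
  · exact ghIso_of_scale one_ne_zero (by rw [hu, hu', h, one_mul]) (by rw [hE, hE']; simp)
  · refine ghIso_trans (ghIso_scale E (w ^ 2) (pow_ne_zero 2 hw0)) ?_
    refine ghIso_trans (ghIso_of_hesse (E' := E') hw h3 ?_ hE' ?_) ?_
    · simp only [GHCurve.scale, hE]
      linear_combination (w ^ 3 + 1) * hw3
    · simp only [GHCurve.scale, hu, hu']
      linear_combination 9 * h + (9 * a * b - 9 * a) * hw3
    · exact (GHCurve.isoSetoid F).iseqv.refl _
  · have : (b * (w * a - 1) - (a + 2 * w ^ 2)) *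
        (b * (w ^ 2 * a - 1) - (a + 2 * (w ^ 2) ^ 2)) = 0 := by
      grind
    rcases mul_eq_zero.1 this with h | h
    · exact ghIso_of_hesse_involution hw h3 hE hE' hu hu' (sub_eq_zero.1 h)
    · exact ghIso_of_hesse_involution (w := w ^ 2) (by linear_combination hw + w * hw3) h3 hE hE'
        hu hu' (sub_eq_zero.1 h)

/-! ### The `j`-invariant and the isomorphism class -/

/-- The quotient of the family by rescaling: the parameter `u³ / (27 v)`. -/
noncomputable def ghParam {F : Type*} [Field F] (E : GHCurve F) : F := E.u ^ 3 / (27 * E.v)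

/-- The `j`-invariant as a function of the parameter `u³ / (27 v)`. -/
noncomputable def hesseJ {F : Type*} [Field F] (s : F) : F :=
  27 * s * (s + 8) ^ 3 / (s - 1) ^ 3

theorem twentySeven_ne_zero {F : Type*} [Field F] (h3 : (3 : F) ≠ 0) : (27 : F) ≠ 0 := by
  rw [show (27 : F) = 3 ^ 3 by norm_num]
  exact pow_ne_zero _ h3

theorem ghParam_ne_one {F : Type*} [Field F] (h3 : (3 : F) ≠ 0) (E : GHCurve F) :
    ghParam E ≠ 1 := by
  rw [ghParam, Ne, div_eq_one_iff_eq (mul_ne_zero (twentySeven_ne_zero h3) E.v_ne_zero)]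
  exact E.nonsingular

theorem exists_ghParam_eq {F : Type*} [Field F] (h3 : (3 : F) ≠ 0) {s : F} (hs : s ≠ 1) :
    ∃ E : GHCurve F, ghParam E = s := by
  have h27 := twentySeven_ne_zero h3
  by_cases h0 : s = 0
  · exact ⟨⟨0, 1, one_ne_zero, by simpa using h27.symm⟩, by simp [ghParam, h0]⟩
  · refine ⟨⟨1, 1 / (27 * s), one_div_ne_zero (mul_ne_zero h27 h0), fun h => hs ?_⟩, ?_⟩
    · field_simp at h
      linear_combination h
    · simp only [ghParam]
      field_simp

theorem ghJ_eq_hesseJ {F : Type*} [Field F] (h3 : (3 : F) ≠ 0) (E : GHCurve F) :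
    ghJ E = hesseJ (ghParam E) := by
  have h27 := twentySeven_ne_zero h3
  have h1 := sub_ne_zero.2 (ghParam_ne_one h3 E)
  have hv := E.v_ne_zero
  have hu : E.u ^ 3 = 27 * E.v * ghParam E := by rw [ghParam]; field_simp
  rw [ghJ, hesseJ, mul_pow, hu, show 27 * E.v * ghParam E - 27 * E.v
    = 27 * E.v * (ghParam E - 1) by ring]
  field_simp
  ring

theorem range_ghJ {F : Type*} [Field F] (h3 : (3 : F) ≠ 0) :
    Set.range (ghJ : GHCurve F → F) = hesseJ '' {s | s ≠ 1} := by
  ext a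
  constructor
  · rintro ⟨E, rfl⟩
    exact ⟨_, ghParam_ne_one h3 E, (ghJ_eq_hesseJ h3 E).symm⟩
  · rintro ⟨s, hs, rfl⟩
    obtain ⟨E, rfl⟩ := exists_ghParam_eq h3 hs
    exact ⟨E, ghJ_eq_hesseJ h3 E⟩

/-- Two different parameters with the same non-zero `j`-invariant are cubes. -/
theorem exists_cube_of_hesseJ_eq {F : Type*} [Field F] (h3 : (3 : F) ≠ 0) {s s' : F} (hs : s ≠ 1)
    (hs' : s' ≠ 1) (hne : s ≠ s') (h0 : hesseJ s ≠ 0) (h : hesseJ s = hesseJ s') :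
    ∃ x, x ^ 3 = s := by
  have h27 := twentySeven_ne_zero h3
  have h0' := h ▸ h0
  have hs1 := sub_ne_zero.2 hs
  have hs1' := sub_ne_zero.2 hs'
  have hs0 : s ≠ 0 := by rintro rfl; simp [hesseJ] at h0
  have hs8 : s + 8 ≠ 0 := fun h8 => h0 (by simp [hesseJ, h8])
  have hs8' : s' + 8 ≠ 0 := fun h8 => h0' (by simp [hesseJ, h8])
  simp only [hesseJ] at h
  -- Equality of `j` makes `s' / s` the cube of this ratio. Substituting `s' = c³ s` back leaves,
  -- after removing `1 - c`, a quadratic in `s` whose roots are the cubes of the roots of `c x² - (1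
  -- + c) x - 2`.
  obtain ⟨c, hc⟩ : ∃ c, c = (s + 8) * (s' - 1) / ((s' + 8) * (s - 1)) := ⟨_, rfl⟩
  have hcs : c ^ 3 * s = s' := by
    rw [hc]
    field_simp at h ⊢
    linear_combination h
  have hc' : c * ((s' + 8) * (s - 1)) = (s + 8) * (s' - 1) := by
    rw [hc]
    field_simp
  have hc1 : 1 - c ≠ 0 := fun h1 => hne (by
    rw [← hcs, show c = 1 by linear_combination -h1]; ring)
  have hc0 : c ≠ 0 := by
    rw [hc]
    positivity
  have key : c ^ 3 * s ^ 2 - (c ^ 3 + 9 * c ^ 2 + 9 * c + 1) * s - 8 = 0 := by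
    apply mul_left_cancel₀ hc1
    rw [← hcs] at hc'
    linear_combination -hc'
  clear hc' hc h
  -- Reducing `x³` modulo `c x² - (1 + c) x - 2` gives `c² s = (c² + 4 c + 1) x + 2 (1 + c)`, to be
  -- solved for `x`. When the coefficient of `x` vanishes both roots have cube `s`, and minus their
  -- sum is the remaining cube root.
  by_cases hd : c ^ 2 + 4 * c + 1 = 0
  · refine ⟨-(1 + c) / c, ?_⟩
    have : (c ^ 2 * s - 2 * (1 + c)) ^ 3 = 0 := by
      linear_combination (c ^ 3 * s + (1 + c) ^ 3) * key + s * (c ^ 2 + 4 * c + 1) ^ 2 * hd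
    have := pow_eq_zero_iff (three_ne_zero) |>.1 this
    field_simp
    linear_combination -(1 + c) * hd - c * this
  · refine ⟨(c ^ 2 * s - 2 * (1 + c)) / (c ^ 2 + 4 * c + 1), ?_⟩
    rw [div_pow, div_eq_iff (pow_ne_zero 3 hd)]
    linear_combination (c ^ 3 * s + (1 + c) ^ 3) * key

theorem exists_ghIso_hesse {F : Type*} [Field F] (h3 : (3 : F) ≠ 0) (E : GHCurve F) {x : F}
    (hx : x ≠ 0) (h : x ^ 3 = ghParam E) :
    ∃ E' : GHCurve F, GHIso E E' ∧ E'.v = 1 ∧ E'.u = 3 * x := by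
  have h27 := twentySeven_ne_zero h3
  have hv := E.v_ne_zero
  rw [ghParam, eq_div_iff (by positivity)] at h
  have hu : E.u ≠ 0 := fun h0 => by
    rw [h0] at h
    exact (mul_ne_zero (pow_ne_zero 3 hx) (mul_ne_zero h27 hv)) (by rw [h]; simp)
  refine ⟨_, ghIso_scale E (3 * x / E.u) (by positivity), ?_, ?_⟩
  · simp only [GHCurve.scale]
    field_simp
    linear_combination h
  · simp only [GHCurve.scale]
    field_simp

/-- Equal parameters differ by a rescaling; unequal ones are both cubes, so both curves can be moved
to `v = 1`, where the Hesse transformations apply. -/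
theorem ghIso_of_ghJ_eq {F : Type*} [Field F] {w : F} (hw : w ^ 2 + w + 1 = 0)
    (h3 : (3 : F) ≠ 0) {E E' : GHCurve F} (h : ghJ E = ghJ E') (h0 : ghJ E ≠ 0) :
    GHIso E E' := by
  have h27 := twentySeven_ne_zero h3
  have h0' := h ▸ h0
  rw [ghJ_eq_hesseJ h3] at h0 h0'
  rw [ghJ_eq_hesseJ h3, ghJ_eq_hesseJ h3] at h
  have hs0 : ghParam E ≠ 0 := fun e => h0 (by rw [e]; simp [hesseJ])
  have hs0' : ghParam E' ≠ 0 := fun e => h0' (by rw [e]; simp [hesseJ])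
  have hs1 := ghParam_ne_one h3 E
  have hs1' := ghParam_ne_one h3 E'
  have hv := E.v_ne_zero
  have hv' := E'.v_ne_zero
  by_cases hne : ghParam E = ghParam E'
  · have hu : E.u ≠ 0 := fun e => hs0 (by rw [ghParam, e]; simp)
    have hu' : E'.u ≠ 0 := fun e => hs0' (by rw [ghParam, e]; simp)
    refine ghIso_of_scale (t := E'.u / E.u) (by positivity) (by field_simp) ?_
    simp only [ghParam] at hne
    field_simp at hne ⊢
    linear_combination hne
  · obtain ⟨x, hx⟩ := exists_cube_of_hesseJ_eq h3 hs1 hs1' hne h0 h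
    obtain ⟨y, hy⟩ := exists_cube_of_hesseJ_eq h3 hs1' hs1 (Ne.symm hne) h0' h.symm
    have hx0 : x ≠ 0 := by rintro rfl; exact hs0 (by rw [← hx]; simp)
    have hy0 : y ≠ 0 := by rintro rfl; exact hs0' (by rw [← hy]; simp)
    rw [← hx] at hs1 h h0
    rw [← hy] at hs1' h h0'
    have hx1 := sub_ne_zero.2 hs1
    have hy1 := sub_ne_zero.2 hs1'
    have hx8 : x ^ 3 + 8 ≠ 0 := fun h8 => h0 (by simp [hesseJ, h8])
    have hy8 : y ^ 3 + 8 ≠ 0 := fun h8 => h0' (by simp [hesseJ, h8])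
    -- The ratio of the two cube roots of `j` is a cube root of unity; replacing `y` by `z y` makes
    -- them equal.
    obtain ⟨z, hz⟩ : ∃ z, z = x * (x ^ 3 + 8) * (y ^ 3 - 1) / (y * (y ^ 3 + 8) * (x ^ 3 - 1)) :=
      ⟨_, rfl⟩
    have hz3 : z ^ 3 = 1 := by
      rw [hz]
      simp only [hesseJ] at h
      field_simp at h ⊢
      linear_combination h
    have hz0 : z ≠ 0 := by rintro rfl; simp at hz3
    have hzy : (z * y) ^ 3 = y ^ 3 := by rw [mul_pow, hz3, one_mul]
    obtain ⟨E₁, hE₁, hv₁, hu₁⟩ := exists_ghIso_hesse h3 E hx0 hx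
    obtain ⟨E₂, hE₂, hv₂, hu₂⟩ := exists_ghIso_hesse h3 E' (mul_ne_zero hz0 hy0) (hzy.trans hy)
    refine ghIso_trans hE₁ (ghIso_trans (ghIso_of_hesse_invariant hw h3 hv₁ hv₂ hu₁ hu₂ ?_)
      (ghIso_symm hE₂))
    rw [hzy, hz]
    field_simp

/-- If `u ≠ 0`, then `j = 0` means parameter `-8 = (-2)³`, and the involution `d ↦ (d + 2) / (d -
1)` sends `-2` to `0`. -/
theorem exists_ghIso_u_eq_zero {F : Type*} [Field F] {w : F} (hw : w ^ 2 + w + 1 = 0)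
    (h3 : (3 : F) ≠ 0) (E : GHCurve F) (h : ghJ E = 0) :
    ∃ E' : GHCurve F, GHIso E E' ∧ E'.u = 0 := by
  by_cases hu : E.u = 0
  · exact ⟨E, (GHCurve.isoSetoid F).iseqv.refl _, hu⟩
  have h27 := twentySeven_ne_zero h3
  have hv := E.v_ne_zero
  have h8 : ghParam E = -8 := by
    have := sub_ne_zero.2 E.nonsingular
    have h216 : E.u ^ 3 + 216 * E.v = 0 := by simpa [ghJ, hu, hv, this] using h
    rw [ghParam]
    field_simp
    linear_combination h216
  have h2 : (2 : F) ≠ 0 := fun h2 => hu (by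
    rw [show (8 : F) = 2 * 4 by norm_num, h2, ghParam] at h8
    simpa [h27, hv] using h8)
  obtain ⟨E₁, hE₁, hv₁, hu₁⟩ := exists_ghIso_hesse h3 E (x := -2) (neg_ne_zero.2 h2)
    (by rw [h8]; norm_num)
  refine ⟨⟨0, 1, one_ne_zero, by simpa using h27.symm⟩, ghIso_trans hE₁
    (ghIso_of_hesse_invariant (b := 0) hw h3 hv₁ rfl hu₁ (by simp) (by norm_num)), rfl⟩

/-- For `u = 0` the discriminant is `-27³ v⁴`, so it agrees with `v` modulo cubes and determines the
rescaling class. -/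
theorem ghIso_of_u_eq_zero {F : Type*} [Field F] {E E' : GHCurve F} (hu : E.u = 0)
    (hu' : E'.u = 0) (h3 : (3 : F) ≠ 0) {y : F}
    (h : (ghWeierstrass E').Δ = y ^ 3 * (ghWeierstrass E).Δ) : GHIso E E' := by
  have hv := E.v_ne_zero
  have hv' := E'.v_ne_zero
  have h27 := twentySeven_ne_zero h3
  rw [ghWeierstrass_Δ, ghWeierstrass_Δ, hu, hu'] at h
  have h4 : E'.v ^ 4 = y ^ 3 * E.v ^ 4 :=
    mul_left_cancel₀ (pow_ne_zero 3 h27) (by linear_combination -h)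
  have hy : y ≠ 0 := by
    rintro rfl
    exact pow_ne_zero 4 hv' (by rw [h4]; simp)
  refine ghIso_of_scale (t := y * E.v / E'.v) (by positivity) (by simp [hu, hu']) ?_
  field_simp
  linear_combination h4

/-! ### Fibres of `hesseGamma` and the number of `j`-invariants -/

theorem card_eq_three_mul_card_image_cube {F : Type*} [Field F] [DecidableEq F] {w : F}
    (hw : w ^ 2 + w + 1 = 0) (h3 : (3 : F) ≠ 0) (S : Finset F) (h0 : 0 ∉ S)
    (hS : ∀ x ∈ S, w * x ∈ S) : S.card = 3 * (S.image (· ^ 3)).card := by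
  have hw3 : w ^ 3 = 1 := by linear_combination (w - 1) * hw
  have hw1 : w ≠ 1 := by rintro rfl; exact h3 (by linear_combination hw)
  have hw0 : w ≠ 0 := by rintro rfl; simp at hw
  rw [Finset.card_eq_sum_card_image (· ^ 3) S, Finset.sum_const_nat (m := 3), mul_comm]
  intro y hy
  obtain ⟨x, hx, rfl⟩ := Finset.mem_image.1 hy
  have hx0 : x ≠ 0 := by rintro rfl; exact h0 hx
  have : S.filter (fun a => a ^ 3 = x ^ 3) = {x, w * x, w * (w * x)} := by
    ext a
    simp only [Finset.mem_filter, Finset.mem_insert, Finset.mem_singleton]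
    constructor
    · rintro ⟨-, h⟩
      have : (a - x) * ((a - w * x) * (a - w * (w * x))) = 0 := by
        linear_combination h - x ^ 3 * hw3 + (-a ^ 2 * x + w * a * x ^ 2) * hw
      simpa [sub_eq_zero] using this
    · rintro (rfl | rfl | rfl)
      · exact ⟨hx, rfl⟩
      · exact ⟨hS _ hx, by rw [mul_pow, hw3, one_mul]⟩
      · exact ⟨hS _ (hS _ hx), by rw [mul_pow, mul_pow, hw3, one_mul, one_mul]⟩
  rw [this, Finset.card_eq_three]
  refine ⟨x, w * x, w * (w * x), ?_, ?_, ?_, rfl⟩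
  · intro h
    exact hw1 (mul_right_cancel₀ hx0 (by linear_combination -h))
  · intro h
    exact hw1 (mul_right_cancel₀ hx0 (by linear_combination w * h + x * hw3))
  · intro h
    exact hw1 (mul_right_cancel₀ hx0 (mul_left_cancel₀ hw0 (by linear_combination -h)))

/-- The rational cube root of the `j`-invariant of the curve `X³ + Y³ + 1 = 3 d X Y`. -/
noncomputable def hesseGamma {F : Type*} [Field F] (d : F) : F :=
  3 * d * (d ^ 3 + 8) / (d ^ 3 - 1)

theorem hesseJ_cube {F : Type*} [Field F] (d : F) : hesseJ (d ^ 3) = hesseGamma d ^ 3 := by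
  rw [hesseJ, hesseGamma, div_pow]
  ring

theorem hesseGamma_mul {F : Type*} [Field F] {z : F} (hz : z ^ 3 = 1) (d : F) :
    hesseGamma (z * d) = z * hesseGamma d := by
  rw [hesseGamma, hesseGamma, mul_pow, hz]
  ring

/-- An involution of the parameter line: `b` is the image of `a` under
`a ↦ (a + 2 w²) / (w a - 1)`. -/
def HesseRel {F : Type*} [Field F] (w a b : F) : Prop := b * (w * a - 1) = a + 2 * w ^ 2

theorem hesseGamma_eq_iff {F : Type*} [Field F] {w a b : F} (hw : w ^ 2 + w + 1 = 0)
    (h3 : (3 : F) ≠ 0) (ha : a ^ 3 ≠ 1) (hb : b ^ 3 ≠ 1) : hesseGamma a = hesseGamma b ↔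
      a = b ∨ HesseRel 1 a b ∨ HesseRel w a b ∨ HesseRel (w ^ 2) a b := by
  have ha1 := sub_ne_zero.2 ha
  have hb1 := sub_ne_zero.2 hb
  have e : hesseGamma a = hesseGamma b ↔
      a * (a ^ 3 + 8) * (b ^ 3 - 1) = b * (b ^ 3 + 8) * (a ^ 3 - 1) := by
    rw [hesseGamma, hesseGamma, div_eq_div_iff ha1 hb1]
    exact ⟨fun h => mul_left_cancel₀ h3 (by linear_combination h),
      fun h => by linear_combination 3 * h⟩
  have f : (a - b) * ((b * (1 * a - 1) - (a + 2 * 1 ^ 2)) *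
      ((b * (w * a - 1) - (a + 2 * w ^ 2)) * (b * (w ^ 2 * a - 1) - (a + 2 * (w ^ 2) ^ 2))))
      = a * (a ^ 3 + 8) * (b ^ 3 - 1) - b * (b ^ 3 + 8) * (a ^ 3 - 1) := by
    have : (b * (w * a - 1) - (a + 2 * w ^ 2)) * (b * (w ^ 2 * a - 1) - (a + 2 * (w ^ 2) ^ 2)) =
      (a * b + 2) ^ 2 + (a * b + 2) * (a + b - 2) + (a + b - 2) ^ 2 := by grind
    rw [this]
    ring
  rw [e, ← sub_eq_zero, ← f]
  simp only [mul_eq_zero, sub_eq_zero, HesseRel]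

/-- The image of `a` under the involution `HesseRel w a`. -/
noncomputable def hesseInv {F : Type*} [Field F] (w a : F) : F := (a + 2 * w ^ 2) / (w * a - 1)

theorem hesseRel_iff {F : Type*} [Field F] {w a b : F} (hw : w ^ 3 = 1) (ha : a ^ 3 ≠ 1) :
    HesseRel w a b ↔ b = hesseInv w a := by
  have : w * a - 1 ≠ 0 := fun h => ha (by
    linear_combination ((w * a) ^ 2 + w * a + 1) * h - a ^ 3 * hw)
  rw [HesseRel, hesseInv, eq_div_iff this]

theorem hesseInv_cube_ne_one {F : Type*} [Field F] {w a : F} (h3 : (3 : F) ≠ 0) (hw : w ^ 3 = 1)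
    (ha : a ^ 3 ≠ 1) : hesseInv w a ^ 3 ≠ 1 := by
  intro h
  have hr := (hesseRel_iff hw ha).2 rfl
  have hw0 : w ≠ 0 := by rintro rfl; simp at hw
  rw [HesseRel] at hr
  have h9 : 9 * (a ^ 3 - 1) = 0 := by
    have : (w * a - 1) ^ 3 = (a + 2 * w ^ 2) ^ 3 := by rw [← hr, mul_pow, h, one_mul]
    grind
  rw [show (9 : F) = 3 * 3 by norm_num] at h9
  exact ha (by simpa [h3, sub_eq_zero] using h9)

/-- Over a fixed point of one of the involutions the `j`-invariant is `1728`. -/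
theorem hesseGamma_cube_of_fixed {F : Type*} [Field F] {w a : F} (hw : w ^ 3 = 1)
    (ha : a ^ 3 ≠ 1) (h : w * a ^ 2 - 2 * a - 2 * w ^ 2 = 0) : hesseGamma a ^ 3 = 1728 := by
  have ha1 := sub_ne_zero.2 ha
  have : hesseGamma a = 12 * w ^ 2 := by
    rw [hesseGamma, div_eq_iff ha1]
    grind
  rw [this, mul_pow, ← pow_mul, mul_comm 2, pow_mul, hw]
  norm_num

/-- The product of two of the involutions is the third, so a point where two of them agree is fixed
by the third. The hypotheses on `x`, `y`, `z` express that they are the three cube roots of unity.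
-/
theorem fixed_of_hesseRel {F : Type*} [Field F] {x y z a b : F} (hxy : x ≠ y)
    (hs : x + y + z = 0) (hp : x * y * z = 1) (hx : HesseRel x a b) (hy : HesseRel y a b) :
    z * a ^ 2 - 2 * a - 2 * z ^ 2 = 0 := by
  rw [HesseRel] at hx hy
  have p : a * b = 2 * (x + y) :=
    mul_left_cancel₀ (sub_ne_zero.2 hxy) (by linear_combination hx - hy)
  have e : a + b = 2 * x * y := by linear_combination -hx + x * p
  linear_combination z * (a * e - p) + 2 * a * hp - 2 * z * hs

theorem card_hesse_orbit {F : Type*} [Field F] [DecidableEq F] {w a : F} (hw : w ^ 2 + w + 1 = 0)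
    (h3 : (3 : F) ≠ 0) (ha : a ^ 3 ≠ 1) (hγ : hesseGamma a ^ 3 ≠ 1728) :
    ({a, hesseInv 1 a, hesseInv w a, hesseInv (w ^ 2) a} : Finset F).card = 4 := by
  have hw3 : w ^ 3 = 1 := by linear_combination (w - 1) * hw
  have hw32 : (w ^ 2) ^ 3 = 1 := by rw [← pow_mul, mul_comm, pow_mul, hw3, one_pow]
  have hw1 : w ≠ 1 := by rintro rfl; exact h3 (by linear_combination hw)
  have hw0 : w ≠ 0 := by rintro rfl; simp at hw
  have r0 := (hesseRel_iff (one_pow 3) ha).2 rfl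
  have r1 := (hesseRel_iff hw3 ha).2 rfl
  have r2 := (hesseRel_iff hw32 ha).2 rfl
  have f0 := fun h => hγ (hesseGamma_cube_of_fixed (one_pow 3) ha h)
  have f1 := fun h => hγ (hesseGamma_cube_of_fixed hw3 ha h)
  have f2 := fun h => hγ (hesseGamma_cube_of_fixed hw32 ha h)
  have g2 : w ^ 2 ≠ 1 := fun h => hw1 (by linear_combination hw3 - w * h)
  have g3 : w ≠ w ^ 2 := fun h => hw1 (mul_left_cancel₀ hw0 (by linear_combination -h))
  have n1 : a ≠ hesseInv 1 a := fun h => f0 (by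
    rw [← h, HesseRel] at r0; linear_combination r0)
  have n2 : a ≠ hesseInv w a := fun h => f1 (by
    rw [← h, HesseRel] at r1; linear_combination r1)
  have n3 : a ≠ hesseInv (w ^ 2) a := fun h => f2 (by
    rw [← h, HesseRel] at r2; linear_combination r2)
  have n4 : hesseInv 1 a ≠ hesseInv w a := fun h => f2 (fixed_of_hesseRel hw1.symm
    (by linear_combination hw) (by linear_combination hw3) r0 (h ▸ r1))
  have n5 : hesseInv 1 a ≠ hesseInv (w ^ 2) a := fun h => f1 (fixed_of_hesseRel g2.symm
    (by linear_combination hw) (by linear_combination hw3) r0 (h ▸ r2))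
  have n6 : hesseInv w a ≠ hesseInv (w ^ 2) a := fun h => f0 (fixed_of_hesseRel g3
    (by linear_combination hw) (by linear_combination hw3) r1 (h ▸ r2))
  rw [Finset.card_insert_of_notMem, Finset.card_insert_of_notMem,
    Finset.card_insert_of_notMem, Finset.card_singleton] <;> simp [*]

theorem hesseGamma_generic_card {F : Type*} [Field F] [Fintype F] [DecidableEq F] {w : F}
    (hw : w ^ 2 + w + 1 = 0) (h3 : (3 : F) ≠ 0) (P : Finset F)
    (hP : ∀ d, d ∈ P ↔ d ^ 3 ≠ 1 ∧ hesseGamma d ^ 3 ≠ 1728) :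
    P.card = 4 * (P.image hesseGamma).card := by
  have hw3 : w ^ 3 = 1 := by linear_combination (w - 1) * hw
  have hw32 : (w ^ 2) ^ 3 = 1 := by rw [← pow_mul, mul_comm, pow_mul, hw3, one_pow]
  rw [Finset.card_eq_sum_card_image hesseGamma P, Finset.sum_const_nat (m := 4), mul_comm]
  intro y hy
  obtain ⟨a, ha, rfl⟩ := Finset.mem_image.1 hy
  obtain ⟨ha1, hγ⟩ := (hP a).1 ha
  rw [← card_hesse_orbit hw h3 ha1 hγ]
  congr 1
  have hr : ∀ b, (a = b ∨ HesseRel 1 a b ∨ HesseRel w a b ∨ HesseRel (w ^ 2) a b) ↔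
      b ∈ ({a, hesseInv 1 a, hesseInv w a, hesseInv (w ^ 2) a} : Finset F) := fun b => by
    rw [hesseRel_iff (one_pow 3) ha1, hesseRel_iff hw3 ha1, hesseRel_iff hw32 ha1]
    simp [eq_comm]
  ext b
  rw [Finset.mem_filter, hP, ← hr]
  constructor
  · rintro ⟨⟨hb, -⟩, h⟩
    exact (hesseGamma_eq_iff hw h3 ha1 hb).1 h.symm
  · intro h
    have hb : b ^ 3 ≠ 1 := by
      have := (hr b).1 h
      simp only [Finset.mem_insert, Finset.mem_singleton] at this
      rcases this with rfl | rfl | rfl | rfl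
      · exact ha1
      · exact hesseInv_cube_ne_one h3 (one_pow 3) ha1
      · exact hesseInv_cube_ne_one h3 hw3 ha1
      · exact hesseInv_cube_ne_one h3 hw32 ha1
    have := (hesseGamma_eq_iff hw h3 ha1 hb).2 h
    exact ⟨⟨hb, this ▸ hγ⟩, this.symm⟩

/-- In characteristic 2 the value is `0`, attained only at `0`. Otherwise each of the three cube
roots of 1728 is attained at the two roots of a quadratic, with multiplicity two, as soon as that
quadratic has a root in the field. -/
theorem hesseGamma_special_card {F : Type*} [Field F] [Fintype F] [DecidableEq F] {w : F}
    (hw : w ^ 2 + w + 1 = 0) (h3 : (3 : F) ≠ 0) (R : Finset F)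
    (hR : ∀ d, d ∈ R ↔ d ^ 3 ≠ 1 ∧ hesseGamma d ^ 3 = 1728) :
    (R.card = 0 ∧ (R.image hesseGamma).card = 0) ∨ (R.card = 1 ∧ (R.image hesseGamma).card = 1) ∨
      (R.card = 6 ∧ (R.image hesseGamma).card = 3) := by
  have hw3 : w ^ 3 = 1 := by linear_combination (w - 1) * hw
  by_cases h2 : (2 : F) = 0
  · right; left
    have hR0 : R = {0} := by
      ext d
      rw [hR, Finset.mem_singleton, show (1728 : F) = 2 * 864 by norm_num, h2, zero_mul,
        pow_eq_zero_iff three_ne_zero]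
      constructor
      · rintro ⟨h1, h⟩
        have := sub_ne_zero.2 h1
        rw [hesseGamma, show (8 : F) = 2 * 4 by norm_num, h2] at h
        simpa [h3, this] using h
      · rintro rfl
        simp [hesseGamma]
    simp [hR0]
  · have hmem : ∀ d, d ∈ R → w * d ∈ R := fun d hd => by
      rw [hR] at hd ⊢
      rw [hesseGamma_mul hw3, mul_pow, mul_pow, hw3, one_mul, one_mul]
      exact hd
    rcases R.eq_empty_or_nonempty with h | ⟨d, hd⟩
    · left
      simp [h]
    · right; right
      have h1728 : (1728 : F) ≠ 0 := by
        rw [show (1728 : F) = 2 ^ 6 * 3 ^ 3 by norm_num]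
        positivity
      have h12 : (12 : F) ≠ 0 := by
        rw [show (12 : F) = 2 ^ 2 * 3 by norm_num]
        positivity
      -- Rotating `d` by a cube root of unity brings the value to 12, and `3 e (e³ + 8) - 12 (e³ -
      -- 1) = 3 (e² - 2 e - 2)²`.
      have fixed : ∀ d ∈ R, ∃ z e, z ^ 3 = 1 ∧ e = z * d ∧ e ^ 2 = 2 * e + 2 := fun d hd => by
        obtain ⟨h1, hγ⟩ := (hR d).1 hd
        have h1' := sub_ne_zero.2 h1
        have hg0 : hesseGamma d ≠ 0 := fun h0 => h1728 (by rw [← hγ, h0]; simp)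
        have hz : (12 / hesseGamma d) ^ 3 = 1 := by
          rw [div_pow, hγ, div_eq_one_iff_eq h1728]
          norm_num
        refine ⟨12 / hesseGamma d, 12 / hesseGamma d * d, hz, rfl, ?_⟩
        have h12' : hesseGamma (12 / hesseGamma d * d) = 12 := by
          rw [hesseGamma_mul hz, div_mul_cancel₀ _ hg0]
        have he : (12 / hesseGamma d * d) ^ 3 - 1 ≠ 0 := by
          rwa [mul_pow, hz, one_mul]
        generalize 12 / hesseGamma d * d = e at *
        rw [hesseGamma, div_eq_iff he] at h12'
        have : (e ^ 2 - 2 * e - 2) ^ 2 = 0 :=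
          mul_left_cancel₀ h3 (by linear_combination h12')
        linear_combination (pow_eq_zero_iff two_ne_zero).1 this
      have of_fixed : ∀ e : F, e ^ 2 = 2 * e + 2 → e ∈ R := fun e he => by
        have h1 : e ^ 3 ≠ 1 := fun h1 => by
          have h4 : 3 * (2 * e + 1) = 0 := by linear_combination h1 - (e + 2) * he
          have h5 : 2 * e + 1 = 0 := by simpa [h3] using h4
          exact h3 (by linear_combination -4 * he + (2 * e - 5) * h5)
        exact (hR e).2 ⟨h1, hesseGamma_cube_of_fixed (w := 1) (one_pow 3) h1
          (by linear_combination he)⟩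
      obtain ⟨z, e, hz, -, he⟩ := fixed d hd
      have he1 : e ≠ 2 - e := fun h => h3 (by
        have : e = 1 := mul_left_cancel₀ h2 (by linear_combination h)
        rw [this] at he
        linear_combination -he)
      have he' : (2 - e) ^ 2 = 2 * (2 - e) + 2 := by linear_combination he
      have cube : ∀ e : F, e ^ 2 = 2 * e + 2 → e ^ 3 = 6 * e + 4 := fun e he => by
        linear_combination (e + 2) * he
      have himage : R.image (· ^ 3) = {6 * e + 4, 6 * (2 - e) + 4} := by
        ext y
        simp only [Finset.mem_image, Finset.mem_insert, Finset.mem_singleton]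
        constructor
        · rintro ⟨d, hd, rfl⟩
          obtain ⟨z, f, hz, rfl, hf⟩ := fixed d hd
          have hd3 : d ^ 3 = (z * d) ^ 3 := by rw [mul_pow, hz, one_mul]
          rw [hd3, cube _ hf]
          have : (z * d - e) * (z * d - (2 - e)) = 0 := by linear_combination hf - he
          rcases mul_eq_zero.1 this with h | h
          · left; rw [sub_eq_zero.1 h]
          · right; rw [sub_eq_zero.1 h]
        · rintro (rfl | rfl)
          · exact ⟨e, of_fixed e he, cube e he⟩
          · exact ⟨2 - e, of_fixed _ he', cube _ he'⟩
      have h6 : (6 : F) ≠ 0 := by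
        rw [show (6 : F) = 2 * 3 by norm_num]
        exact mul_ne_zero h2 h3
      constructor
      · rw [card_eq_three_mul_card_image_cube hw h3 R ?_ hmem, himage, Finset.card_pair]
        · exact fun h => he1 (mul_left_cancel₀ h6 (by linear_combination h))
        · intro h0
          have := ((hR 0).1 h0).2
          exact h1728 (by rw [← this]; simp [hesseGamma])
      · have : (R.image hesseGamma).image (· ^ 3) = {1728} := by
          ext y
          simp only [Finset.mem_image, Finset.mem_singleton, exists_exists_and_eq_and]
          constructor
          · rintro ⟨d, hd, rfl⟩
            exact ((hR d).1 hd).2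
          · rintro rfl
            exact ⟨d, hd, ((hR d).1 hd).2⟩
        rw [card_eq_three_mul_card_image_cube hw h3 _ ?_ ?_, this, Finset.card_singleton]
        · intro h0
          obtain ⟨d, hd, h⟩ := Finset.mem_image.1 h0
          exact h1728 (by rw [← ((hR d).1 hd).2, h]; simp)
        · intro y hy
          obtain ⟨d, hd, rfl⟩ := Finset.mem_image.1 hy
          exact Finset.mem_image.2 ⟨w * d, hmem d hd, hesseGamma_mul hw3 d⟩

theorem card_cube_ne_one {F : Type*} [Field F] [Fintype F] [DecidableEq F] {w : F}
    (hw : w ^ 2 + w + 1 = 0) (h3 : (3 : F) ≠ 0) (K : Finset F) (hK : ∀ d, d ∈ K ↔ d ^ 3 ≠ 1) :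
    K.card + 3 = Fintype.card F := by
  have hw3 : w ^ 3 = 1 := by linear_combination (w - 1) * hw
  have hw1 : w ≠ 1 := by rintro rfl; exact h3 (by linear_combination hw)
  have hw0 : w ≠ 0 := by rintro rfl; simp at hw
  have hc : Kᶜ = {1, w, w ^ 2} := by
    ext d
    rw [Finset.mem_compl, hK, not_not]
    simp only [Finset.mem_insert, Finset.mem_singleton]
    constructor
    · intro h
      have : (d - 1) * ((d - w) * (d - w ^ 2)) = 0 := by
        linear_combination h - hw3 + (-d ^ 2 + d * w) * hw
      simpa [sub_eq_zero] using this
    · rintro (rfl | rfl | rfl)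
      · simp
      · exact hw3
      · rw [← pow_mul, mul_comm, pow_mul, hw3, one_pow]
  have h : (Kᶜ).card = 3 := by
    rw [hc, Finset.card_eq_three]
    refine ⟨1, w, w ^ 2, hw1.symm, ?_, ?_, rfl⟩
    · exact fun h => hw1 (by linear_combination hw3 + w * h)
    · exact fun h => hw1 (mul_left_cancel₀ hw0 (by linear_combination -h))
  rw [← h, Finset.card_add_card_compl]

theorem numJGH_of_cube_root {F : Type*} [Field F] [Finite F] {w : F} (hw : w ^ 2 + w + 1 = 0)
    (h3 : (3 : F) ≠ 0) : numJGH F = (3 * Nat.card F + 1) / 4 := by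
  classical
  have := Fintype.ofFinite F
  have hw3 : w ^ 3 = 1 := by linear_combination (w - 1) * hw
  have hw0 : w ≠ 0 := by rintro rfl; simp at hw
  obtain ⟨K, hK⟩ : ∃ K : Finset F, ∀ d, d ∈ K ↔ d ^ 3 ≠ 1 :=
    ⟨Finset.univ.filter (fun d => d ^ 3 ≠ 1), by simp⟩
  obtain ⟨N, hN⟩ : ∃ N : Finset F, ∀ s, s ∈ N ↔ ∀ x, x ^ 3 ≠ s :=
    ⟨Finset.univ.filter (fun s => ∀ x, x ^ 3 ≠ s), by simp⟩
  have hN1 : ∀ s ∈ N, s ≠ 1 := fun s hs h => (hN s).1 hs 1 (by rw [h, one_pow])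
  have hJN : ∀ s ∈ N, hesseJ s ≠ 0 := fun s hs h => by
    have h27 := twentySeven_ne_zero h3
    have h1 := sub_ne_zero.2 (hN1 s hs)
    have : s = 0 ∨ s + 8 = 0 := by simpa [hesseJ, h27, h1] using h
    rcases this with h | h
    · exact (hN s).1 hs 0 (by rw [h]; simp)
    · exact (hN s).1 hs (-2) (by linear_combination -h)
  have hinj : ∀ s ∈ N, ∀ s', s' ≠ 1 → hesseJ s = hesseJ s' → s = s' := fun s hs s' hs' h => by
    by_contra hne
    obtain ⟨x, hx⟩ := exists_cube_of_hesseJ_eq h3 (hN1 s hs) hs' hne (hJN s hs) h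
    exact (hN s).1 hs x hx
  -- the `j`-invariants come from the non-cubes, injectively, and from the cubes
  have hset : (Set.range (ghJ : GHCurve F → F)) =
      ((N.image hesseJ ∪ (K.image hesseGamma).image (· ^ 3) : Finset F) : Set F) := by
    rw [range_ghJ h3]
    ext a
    simp only [Set.mem_image, Set.mem_ofPred_eq, Finset.coe_union, Finset.coe_image, Set.mem_union,
      Finset.mem_coe, exists_exists_and_eq_and]
    constructor
    · rintro ⟨s, hs, rfl⟩
      by_cases h : ∃ x, x ^ 3 = s
      · obtain ⟨x, rfl⟩ := h
        exact Or.inr ⟨x, (hK x).2 hs, (hesseJ_cube x).symm⟩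
      · exact Or.inl ⟨s, (hN s).2 (not_exists.1 h), rfl⟩
    · rintro (⟨s, hs, rfl⟩ | ⟨x, hx, rfl⟩)
      · exact ⟨s, hN1 s hs, rfl⟩
      · exact ⟨x ^ 3, (hK x).1 hx, hesseJ_cube x⟩
  have hdisj : Disjoint (N.image hesseJ) ((K.image hesseGamma).image (· ^ 3)) := by
    rw [Finset.disjoint_left]
    intro a ha ha'
    obtain ⟨s, hs, rfl⟩ := Finset.mem_image.1 ha
    simp only [Finset.mem_image, exists_exists_and_eq_and] at ha'
    obtain ⟨x, hx, h⟩ := ha'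
    rw [← hesseJ_cube] at h
    exact (hN s).1 hs x (hinj s hs _ ((hK x).1 hx) h.symm).symm
  have hNimage : (N.image hesseJ).card = N.card :=
    Finset.card_image_of_injOn fun s hs s' hs' h => hinj s hs s' (hN1 s' hs') h
  rw [numJGH_eq_ncard_range, hset, Set.ncard_coe_finset, Finset.card_union_of_disjoint hdisj,
    hNimage, Nat.card_eq_fintype_card]
  have hq3 := card_cube_ne_one hw h3 K hK
  -- the number of non-cubes
  have hcubes := card_eq_three_mul_card_image_cube hw h3 (Finset.univ.erase (0 : F)) (by simp)
    (fun x hx => by simpa [hw0] using hx)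
  rw [Finset.card_erase_of_mem (Finset.mem_univ _), Finset.card_univ] at hcubes
  have hNcard : N.card + ((Finset.univ.erase (0 : F)).image (· ^ 3)).card + 1
      = Fintype.card F := by
    have hd : Disjoint N ((Finset.univ.erase (0 : F)).image (· ^ 3)) := by
      rw [Finset.disjoint_left]
      intro s hs hs'
      obtain ⟨x, -, rfl⟩ := Finset.mem_image.1 hs'
      exact (hN _).1 hs x rfl
    have h0 : (0 : F) ∉ N ∪ (Finset.univ.erase (0 : F)).image (· ^ 3) := by
      simp only [Finset.mem_union, not_or]
      exact ⟨fun h => (hN 0).1 h 0 (by simp), by simp⟩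
    rw [← Finset.card_union_of_disjoint hd, ← Finset.card_insert_of_notMem h0, ← Finset.card_univ]
    congr 1
    refine Finset.eq_univ_of_forall fun s => ?_
    simp only [Finset.mem_insert, Finset.mem_union, Finset.mem_image, Finset.mem_erase,
      Finset.mem_univ, and_true, hN]
    by_cases h : ∃ x, x ^ 3 = s
    · obtain ⟨x, rfl⟩ := h
      by_cases hx : x = 0
      · left; simp [hx]
      · exact Or.inr (Or.inr ⟨x, hx, rfl⟩)
    · exact Or.inr (Or.inl (not_exists.1 h))
  -- the cubes of the values of `hesseGamma`
  have h0Γ : (0 : F) ∈ K.image hesseGamma :=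
    Finset.mem_image.2 ⟨0, (hK 0).2 (by simp), by simp [hesseGamma]⟩
  have hΓ := card_eq_three_mul_card_image_cube hw h3 ((K.image hesseGamma).erase 0) (by simp)
    (fun y hy => by
      obtain ⟨hy0, hy⟩ := Finset.mem_erase.1 hy
      obtain ⟨d, hd, rfl⟩ := Finset.mem_image.1 hy
      refine Finset.mem_erase.2 ⟨mul_ne_zero hw0 hy0, Finset.mem_image.2 ⟨w * d, ?_,
        hesseGamma_mul hw3 d⟩⟩
      rw [hK] at hd ⊢
      rwa [mul_pow, hw3, one_mul])
  rw [Finset.card_erase_of_mem h0Γ] at hΓ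
  have hΓcube : ((K.image hesseGamma).image (· ^ 3)).card
      = (((K.image hesseGamma).erase 0).image (· ^ 3)).card + 1 := by
    have h0 : (0 : F) ∉ ((K.image hesseGamma).erase 0).image (· ^ 3) := by simp
    rw [← Finset.card_insert_of_notMem h0]
    conv_lhs => rw [← Finset.insert_erase h0Γ, Finset.image_insert]
    simp
  have hΓpos : 0 < (K.image hesseGamma).card := Finset.card_pos.2 ⟨0, h0Γ⟩
  -- the fibres of `hesseGamma`
  have hP := hesseGamma_generic_card hw h3 (K.filter fun d => hesseGamma d ^ 3 ≠ 1728)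
    (by simp [hK])
  have hR := hesseGamma_special_card hw h3 (K.filter fun d => ¬ hesseGamma d ^ 3 ≠ 1728)
    (by simp [hK])
  have hPR := Finset.card_filter_add_card_filter_not (s := K)
    (fun d => hesseGamma d ^ 3 ≠ 1728)
  have hΓPR := Finset.card_filter_add_card_filter_not (s := K.image hesseGamma)
    (fun y => y ^ 3 ≠ 1728)
  rw [Finset.filter_image, Finset.filter_image] at hΓPR
  -- The three cases of `hR` force `q ≡ 3, 0, 1` modulo 4, with totals `(3 q - 1) / 4`, `3 q / 4`,
  -- `(3 q + 1) / 4`; all equal the stated integer quotient.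
  omega

/-! ### The cubic character, the classes with `j = 0`, and the conclusion -/

/-- With `n = (q - 1) / 3`, the map `x ↦ xⁿ` on the cyclic group of units has image the cube roots
of unity and kernel the cubes; a generator goes to a primitive root. -/
theorem exists_cubic_character {F : Type*} [Field F] [Finite F] (h : Nat.card F ≡ 1 [MOD 3]) :
    ∃ n : ℕ, (∀ x : F, x ≠ 0 → (x ^ n) ^ 3 = 1) ∧ (∀ x : F, x ≠ 0 → x ^ n = 1 → ∃ y, y ^ 3 = x) ∧
      ∃ g : F, g ≠ 0 ∧ (g ^ n) ^ 2 + g ^ n + 1 = 0 := by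
  have := Fintype.ofFinite F
  have hq1 : 1 < Nat.card F := Finite.one_lt_card
  obtain ⟨n, hn⟩ : ∃ n, Nat.card F = 3 * n + 1 := ⟨Nat.card F / 3, by
    have : Nat.card F % 3 = 1 := h
    omega⟩
  have hn0 : 0 < n := by omega
  have hcard : Nat.card Fˣ = 3 * n := by
    rw [Nat.card_units, hn, Nat.add_sub_cancel]
  have hpow : ∀ x : F, x ≠ 0 → (x ^ n) ^ 3 = 1 := fun x hx => by
    rw [← pow_mul, mul_comm, ← hcard]
    exact congrArg Units.val (pow_card_eq_one' (x := Units.mk0 x hx))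
  obtain ⟨g, hg⟩ := IsCyclic.exists_generator (α := Fˣ)
  have hord : orderOf g = 3 * n := by rw [orderOf_eq_card_of_forall_mem_zpowers hg, hcard]
  refine ⟨n, hpow, fun x hx hxn => ?_, g, g.ne_zero, ?_⟩
  · obtain ⟨k, hk : g ^ k = Units.mk0 x hx⟩ :=
      mem_powers_iff_mem_zpowers.2 (hg (Units.mk0 x hx))
    have h1 : g ^ (k * n) = 1 := by
      rw [pow_mul, hk]
      ext
      simpa using hxn
    have h2 := orderOf_dvd_of_pow_eq_one h1
    rw [hord] at h2
    obtain ⟨l, rfl⟩ := Nat.dvd_of_mul_dvd_mul_right hn0 h2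
    refine ⟨((g ^ l : Fˣ) : F), ?_⟩
    rw [← Units.val_pow_eq_pow_val, ← pow_mul, mul_comm, hk, Units.val_mk0]
  · have h1 : (g : F) ^ n ≠ 1 := fun h1 => by
      have h2 : g ^ n = 1 := by ext; simpa using h1
      have h3 := Nat.le_of_dvd hn0 (orderOf_dvd_of_pow_eq_one h2)
      omega
    exact mul_left_cancel₀ (sub_ne_zero.2 h1) (by linear_combination hpow g g.ne_zero)

theorem numIsoGH_eq_ncard_range {F β : Type*} [Field F] (f : GHCurve F → β)
    (hf : ∀ E E', GHIso E E' ↔ f E = f E') : numIsoGH F = (Set.range f).ncard := by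
  rw [numIsoGH, ← Nat.card_coe_set_eq]
  let φ : Quotient (GHCurve.isoSetoid F) → Set.range f :=
    Quotient.lift (fun E => (⟨f E, E, rfl⟩ : Set.range f))
      fun E E' h => Subtype.ext ((hf E E').1 h)
  refine Nat.card_eq_of_bijective φ ⟨fun x y => ?_, ?_⟩
  · induction x using Quotient.inductionOn
    induction y using Quotient.inductionOn
    exact fun h => Quotient.sound ((hf _ _).2 (congrArg Subtype.val h))
  · rintro ⟨_, E, rfl⟩
    exact ⟨Quotient.mk _ E, rfl⟩

theorem numIsoGH_eq_numJGH_add_two {F : Type*} [Field F] [Finite F]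
    (h : Nat.card F ≡ 1 [MOD 3]) (h3 : (3 : F) ≠ 0) : numIsoGH F = numJGH F + 2 := by
  classical
  obtain ⟨n, hpow, hcube, g, hg0, hw⟩ := exists_cubic_character (F := F) h
  have h27 := twentySeven_ne_zero h3
  set w := g ^ n with hwdef
  have hw3 : w ^ 3 = 1 := by linear_combination (w - 1) * hw
  have hw1 : w ≠ 1 := by rintro h; rw [h] at hw; exact h3 (by linear_combination hw)
  have hw0 : w ≠ 0 := by rintro h; rw [h] at hw; simp at hw
  have hw2 : w ^ 2 ≠ 1 := fun h => hw1 (by linear_combination hw3 - w * h)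
  have hww : w ≠ w ^ 2 := fun h => hw1 (mul_left_cancel₀ hw0 (by linear_combination -h))
  -- A complete invariant: `Δ` changes by twelfth powers, so its cubic character is well defined on
  -- classes. It is recorded only where `j` fails to separate them.
  let f : GHCurve F → F × F := fun E =>
    (ghJ E, if ghJ E = 0 then (ghWeierstrass E).Δ ^ n else 1)
  have hf : ∀ E E', GHIso E E' → f E = f E' := fun E E' hEE => by
    obtain ⟨t, ht, -, -, hΔ⟩ := exists_of_ghIso hEE
    have : (ghWeierstrass E).Δ ^ n = (ghWeierstrass E').Δ ^ n := by
      rw [hΔ, mul_pow, ← pow_mul, show 12 * n = n * 3 * 4 by ring, pow_mul, pow_mul, hpow t ht,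
        one_pow, one_mul]
    simp only [f, ghJ_eq_of_ghIso hEE, this]
  have hf' : ∀ E E', f E = f E' → GHIso E E' := fun E E' hEE => by
    have hj : ghJ E = ghJ E' := congrArg Prod.fst hEE
    by_cases h0 : ghJ E = 0
    · obtain ⟨E₁, h₁, hu₁⟩ := exists_ghIso_u_eq_zero hw h3 E h0
      obtain ⟨E₂, h₂, hu₂⟩ := exists_ghIso_u_eq_zero hw h3 E' (hj ▸ h0)
      have h12 := congrArg Prod.snd ((hf _ _ h₁).symm.trans (hEE.trans (hf _ _ h₂)))
      have j₁ : ghJ E₁ = 0 := (ghJ_eq_of_ghIso h₁).symm.trans h0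
      have j₂ : ghJ E₂ = 0 := (ghJ_eq_of_ghIso h₂).symm.trans (hj ▸ h0)
      simp only [f, j₁, j₂, if_true] at h12
      have hΔ₁ := ghWeierstrass_Δ_ne_zero E₁
      have hΔ₂ := ghWeierstrass_Δ_ne_zero E₂
      obtain ⟨y, hy⟩ := hcube ((ghWeierstrass E₂).Δ / (ghWeierstrass E₁).Δ)
        (div_ne_zero hΔ₂ hΔ₁) (by rw [div_pow, h12, div_self (pow_ne_zero _ hΔ₂)])
      exact ghIso_trans h₁ (ghIso_trans
        (ghIso_of_u_eq_zero hu₁ hu₂ h3 (by rw [hy, div_mul_cancel₀ _ hΔ₁])) (ghIso_symm h₂))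
    · exact ghIso_of_ghJ_eq hw h3 hj h0
  -- These curves have discriminant `(-27 v)³ v`, hence character `vⁿ`; taking `v` equal to `1`, `g`
  -- and `g²` realizes all three values over `j = 0`.
  let E₀ : ∀ v : F, v ≠ 0 → GHCurve F := fun v hv =>
    ⟨0, v, hv, fun h0 => mul_ne_zero h27 hv (by rw [← h0]; simp)⟩
  have hE₀ : ∀ v hv, f (E₀ v hv) = (0, v ^ n) := fun v hv => by
    have hj : ghJ (E₀ v hv) = 0 := by simp [ghJ, E₀]
    have hΔ : (ghWeierstrass (E₀ v hv)).Δ = (-(27 * v)) ^ 3 * v := by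
      rw [ghWeierstrass_Δ]
      simp only [E₀]
      ring
    simp only [f, hj, if_true, hΔ]
    rw [mul_pow, ← pow_mul, mul_comm 3, pow_mul, hpow _ (neg_ne_zero.2 (mul_ne_zero h27 hv)),
      one_mul]
  have hgg : (g ^ 2) ^ n = w ^ 2 := by rw [← pow_mul, mul_comm, pow_mul]
  have hrange : Set.range f =
      insert (0, w) (insert (0, w ^ 2) ((fun a => (a, (1 : F))) '' Set.range ghJ)) := by
    ext p
    simp only [Set.mem_range, Set.mem_insert_iff, Set.mem_image, exists_exists_eq_and]
    constructor
    · rintro ⟨E, rfl⟩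
      by_cases h0 : ghJ E = 0
      · have hz := hpow _ (ghWeierstrass_Δ_ne_zero E)
        simp only [f, h0, if_true, Prod.mk.injEq, true_and]
        generalize (ghWeierstrass E).Δ ^ n = z at hz
        have : (z - w) * ((z - w ^ 2) * (z - 1)) = 0 := by
          linear_combination hz - hw3 + (-z ^ 2 + z * w) * hw
        rcases mul_eq_zero.1 this with h | h
        · exact Or.inl (sub_eq_zero.1 h)
        · rcases mul_eq_zero.1 h with h | h
          · exact Or.inr (Or.inl (sub_eq_zero.1 h))
          · exact Or.inr (Or.inr ⟨E, h0, (sub_eq_zero.1 h).symm⟩)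
      · exact Or.inr (Or.inr ⟨E, by simp [f, h0]⟩)
    · rintro (rfl | rfl | ⟨E, rfl⟩)
      · exact ⟨E₀ g hg0, hE₀ g hg0⟩
      · exact ⟨E₀ (g ^ 2) (pow_ne_zero 2 hg0), by rw [hE₀, hgg]⟩
      · by_cases h0 : ghJ E = 0
        · exact ⟨E₀ 1 one_ne_zero, by rw [hE₀, h0, one_pow]⟩
        · exact ⟨E, by simp [f, h0]⟩
  rw [numIsoGH_eq_ncard_range f fun E E' => ⟨hf E E', hf' E E'⟩, hrange,
    Set.ncard_insert_of_notMem, Set.ncard_insert_of_notMem, Set.ncard_image_of_injective,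
    numJGH_eq_ncard_range]
  · exact fun a b hab => congrArg Prod.fst hab
  · rintro ⟨a, -, ha⟩
    exact hw2 (congrArg Prod.snd ha).symm
  · rintro (h | ⟨a, -, ha⟩)
    · exact hww (congrArg Prod.snd h)
    · exact hw1 (congrArg Prod.snd ha).symm

theorem mainTheorem9 (F : Type*) [Field F] [Finite F] (q : ℕ) (hq : Nat.card F = q) :
    (q ≡ 1 [MOD 3] → numIsoGH F = ⌊(3 * ((q : ℚ) + 3)) / 4⌋₊ ∧ numIsoGH F = numJGH F + 2) ∧
    (q ≡ 0 [MOD 3] ∨ q ≡ 2 [MOD 3] → (numIsoGH F : ℤ) = (q : ℤ) - 1) := by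
  subst hq
  constructor
  · intro h
    have h3 : (3 : F) ≠ 0 := fun h0 => by
      have h1 : Nat.card F % 3 = 1 := h
      have := three_eq_zero_iff.1 h0
      omega
    obtain ⟨n, -, -, g, -, hw⟩ := exists_cubic_character (F := F) h
    have hI := numIsoGH_eq_numJGH_add_two h h3
    refine ⟨?_, hI⟩
    -- Since `3 (q + 3) = (3 q + 1) + 8`, the two extra classes are absorbed in the floor.
    rw [hI, numJGH_of_cube_root hw h3, show (3 * ((Nat.card F : ℚ) + 3)) / 4
      = ((3 * (Nat.card F + 3) : ℕ) : ℚ) / ((4 : ℕ) : ℚ) by push_cast; ring,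
      Nat.floor_div_eq_div]
    omega
  · intro h
    have h1 : ¬ Nat.card F ≡ 1 [MOD 3] := fun h1 => by
      simp only [Nat.ModEq] at h h1
      omega
    have hq1 : 1 < Nat.card F := Finite.one_lt_card
    rw [numIsoGH_of_cube_bijective (cube_bijective h1)]
    omega
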